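/- All graphs are finite and simple. For $t,\Delta\in\mathbb{N}$, a $(t,\Delta)$-tree is a tree with maximum degree at most $\Delta$ and at most $t$ vertices of degree at least $3$. A graph $G$ is $(t,\Delta)$-tree convex if it is bipartite with some bipartition $(A,B)$ for which there is a $(t,\Delta)$-tree $H$ with $V(H)=A$ such that, for every $b\in B$, the set of neighbours of $b$ is empty or induces a connected subgraph of $H$. A branch decomposition of $G$ is a pair $(T,\delta)$ of a tree $T$ of maximum degree at most $3$ and a bijection $\delta$ from $V(G)$ to the leaves of $T$ (the vertex of a one-vertex tree counts as a leaf). Every edge $e$ of $T$ splits $V(G)$ into two parts $A_e,\overline{A_e}$ according to the components of $T-e$; $\mathrm{mimw}_G(T,\delta)$ is the maximum over all $e$ of the size of a largest induced matching in the bipartite graph formed by the edges of $G$ between $A_e$ and $\overline{A_e}$ (and $0$ if $T$ has no edge), and the mim-width $\mathrm{mimw}(G)$ is the minimum of $\mathrm{mimw}_G(T,\delta)$ over all branch decompositions of $G$. **Theorem.** Let $t,\Delta\in\mathbb{N}$ with $t\ge 1$ and $\Delta\ge 3$, and put $$f(t,\Delta)=\max\left\{2\left\lfloor\left(\tfrac{\Delta}{2}\right)^2\right\rfloor,\,2\Delta-1\right\}+t^2\Delta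 .$$ Then every $(t,\Delta)$-tree convex graph $G$ satisfies $\mathrm{mimw}(G)\le f(t,\Delta)$. Moreover, there is an algorithm (depending on $t$ and $\Delta$) that, given a $(t,\Delta)$-tree convex graph $G$, computes in time polynomial in $|V(G)|$ a branch decomposition $(T,\delta)$ of $G$ with $\mathrm{mimw}_G(T,\delta)\le f(t,\Delta)$. -/

import Mathlib

namespace TreeConvex

noncomputable section

universe u

/-! ### Tree convex graphs -/

/-- The degree of a vertex, with values in `ℕ∞`. -/
def deg {V : Type u} (G : SimpleGraph V) (v : V) : ℕ∞ := (G.neighborSet v).encard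

/-- A `(t, Δ)`-tree: a tree with maximum degree at most `Δ` and at most `t` vertices of degree at
least `3`. -/
structure IsBoundedTree (t Δ : ℕ) {W : Type u} (H : SimpleGraph W) : Prop where
  isTree : H.IsTree
  deg_le : ∀ w, deg H w ≤ Δ
  branching_le : {w | 3 ≤ deg H w}.encard ≤ t

/-- `G` is a `(t, Δ)`-tree convex graph: it is a bipartite graph with parts `A` and `B`, and there
is a `(t, Δ)`-tree `H` with vertex set `A` such that the neighbourhood of every `b ∈ B` induces a
connected subgraph of `H`. (Isolated vertices `b` are allowed: the empty subgraph counts as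
connected here.) -/
def IsTreeConvex (t Δ : ℕ) {V : Type u} (G : SimpleGraph V) : Prop :=
  ∃ A B : Set V, A ∪ B = Set.univ ∧ G.IsBipartiteWith A B ∧
    ∃ H : SimpleGraph A, IsBoundedTree t Δ H ∧
      ∀ b ∈ B, (H.induce {a : A | G.Adj b a}).Preconnected

/-! ### Mim-width -/

/-- `M` is an induced matching of `H`: a set of edges such that different edges share no endpoint
and no edge of `H` joins vertices of different edges of `M`. -/
def IsInducedMatching {V : Type u} (H : SimpleGraph V) (M : Set (Sym2 V)) : Prop :=
  M ⊆ H.edgeSet ∧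
    ∀ e ∈ M, ∀ f ∈ M, e ≠ f → ∀ u ∈ e, ∀ v ∈ f, u ≠ v ∧ ¬ H.Adj u v

/-- The maximum size of an induced matching in the bipartite graph formed by the edges of `G`
between `X` and its complement. -/
def cutMim {V : Type u} (G : SimpleGraph V) (X : Set V) : ℕ∞ :=
  ⨆ (M : Set (Sym2 V)) (_ : IsInducedMatching (G.between X Xᶜ) M), M.encard

/-- A branch decomposition of a graph with vertex set `V`: a finite subcubic tree `T` with a
bijection `δ` from `V` to the leaves of `T`. A leaf is a vertex of degree at most one, so that the
vertex of a one-vertex tree is a leaf. -/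
structure BranchDecomposition (V : Type u) where
  /-- the number of nodes of the tree -/
  m : ℕ
  /-- the tree -/
  T : SimpleGraph (Fin m)
  isTree : T.IsTree
  subcubic : ∀ x, deg T x ≤ 3
  /-- the bijection to the leaves -/
  δ : V ≃ {x : Fin m // deg T x ≤ 1}

/-- For an edge `xy` of the tree, the vertices mapped to the component of `T - xy` that
contains `x`. -/
def BranchDecomposition.side {V : Type u} (D : BranchDecomposition V) (x y : Fin D.m) : Set V :=
  {v | (D.T.deleteEdges {s(x, y)}).Reachable x (D.δ v)}

/-- The mim-width of a branch decomposition of `G`: the maximum, over all tree edges, of the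
value of the induced cut. -/
def BranchDecomposition.mimw {V : Type u} (D : BranchDecomposition V) (G : SimpleGraph V) : ℕ∞ :=
  ⨆ (x : Fin D.m) (y : Fin D.m) (_ : D.T.Adj x y), cutMim G (D.side x y)

/-- The mim-width of `G`: the minimum over all branch decompositions. -/
def mimWidth {V : Type u} (G : SimpleGraph V) : ℕ∞ :=
  ⨅ D : BranchDecomposition V, D.mimw G

/-- `max {2 ⌊(Δ/2)²⌋, 2Δ - 1} + t² Δ`. -/
def mimBound (t Δ : ℕ) : ℕ :=
  max (2 * ⌊((Δ : ℚ) / 2) ^ 2⌋₊) (2 * Δ - 1) + t ^ 2 * Δ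

/-! ### Random access machine programs with a step count

The machine has registers and finitely many arrays (those named in the program), all holding
natural numbers. The arithmetic operations are addition and truncated subtraction only, so that
the bit length of a number grows by at most one in each operation and the unit-cost measure is
polynomially related to the time of Turing machines. -/

/-- A state: the contents of the registers and of the arrays. -/
structure State where
  /-- the contents of the register `x` -/
  reg : ℕ → ℕ
  /-- the contents of cell `i` of the array `a` -/
  arr : ℕ → ℕ → ℕ

/-- Arithmetic expressions. -/
inductive Expr where
  | const (c : ℕ)
  | reg (x : ℕ)
  | read (a : ℕ) (i : Expr)
  | add (e₁ e₂ : Expr)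
  | sub (e₁ e₂ : Expr)

/-- The value of an expression. -/
def Expr.eval (s : State) : Expr → ℕ
  | .const c => c
  | .reg x => s.reg x
  | .read a i => s.arr a (i.eval s)
  | .add e₁ e₂ => e₁.eval s + e₂.eval s
  | .sub e₁ e₂ => e₁.eval s - e₂.eval s

/-- The number of steps needed to evaluate an expression. -/
def Expr.cost : Expr → ℕ
  | .const _ => 1
  | .reg _ => 1
  | .read _ i => i.cost + 1
  | .add e₁ e₂ => e₁.cost + e₂.cost + 1
  | .sub e₁ e₂ => e₁.cost + e₂.cost + 1

/-- Programs. A test `e` succeeds if the value of `e` is not zero. -/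
inductive Prog where
  | skip
  | assign (x : ℕ) (e : Expr)
  | write (a : ℕ) (i e : Expr)
  | seq (p q : Prog)
  | cond (e : Expr) (p q : Prog)
  | loop (e : Expr) (p : Prog)

/-- `Exec p s s' k`: started in the state `s`, the program `p` halts in the state `s'` after
exactly `k` steps. -/
inductive Exec : Prog → State → State → ℕ → Prop where
  | skip (s : State) : Exec .skip s s 1
  | assign (s : State) (x : ℕ) (e : Expr) :
      Exec (.assign x e) s { s with reg := Function.update s.reg x (e.eval s) } (e.cost + 1)
  | write (s : State) (a : ℕ) (i e : Expr) :
      Exec (.write a i e) s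
        { s with
          arr := Function.update s.arr a (Function.update (s.arr a) (i.eval s) (e.eval s)) }
        (i.cost + e.cost + 1)
  | seq {p q : Prog} {s s' s'' : State} {k l : ℕ} :
      Exec p s s' k → Exec q s' s'' l → Exec (.seq p q) s s'' (k + l)
  | cond_true {e : Expr} {p q : Prog} {s s' : State} {k : ℕ} :
      e.eval s ≠ 0 → Exec p s s' k → Exec (.cond e p q) s s' (e.cost + 1 + k)
  | cond_false {e : Expr} {p q : Prog} {s s' : State} {k : ℕ} :
      e.eval s = 0 → Exec q s s' k → Exec (.cond e p q) s s' (e.cost + 1 + k)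
  | loop_true {e : Expr} {p : Prog} {s s' s'' : State} {k l : ℕ} :
      e.eval s ≠ 0 → Exec p s s' k → Exec (.loop e p) s' s'' l →
        Exec (.loop e p) s s'' (e.cost + 1 + k + l)
  | loop_false {e : Expr} {p : Prog} {s : State} :
      e.eval s = 0 → Exec (.loop e p) s s (e.cost + 1)

open Classical in
/-- The input state for a graph `G` on `n` vertices: register `0` holds `n`, array `0` holds the
adjacency matrix of `G` row by row, and everything else is zero. -/
def inputState {n : ℕ} (G : SimpleGraph (Fin n)) : State where
  reg := fun x => if x = 0 then n else 0
  arr := fun a k =>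
    if a = 0 ∧ ∃ i j : Fin n, G.Adj i j ∧ k = (i : ℕ) * n + (j : ℕ) then 1 else 0

/-- The state `s` holds the branch decomposition `D`: register `0` holds the number `m` of nodes of
the tree, array `0` holds the adjacency matrix of the tree row by row (nonzero entries stand for
edges), and cell `v` of array `1` holds the leaf of the vertex `v`. -/
structure Holds {n : ℕ} (s : State) (D : BranchDecomposition (Fin n)) : Prop where
  size : s.reg 0 = D.m
  adj : ∀ x y : Fin D.m, D.T.Adj x y ↔ s.arr 0 ((x : ℕ) * D.m + (y : ℕ)) ≠ 0
  leaf : ∀ v : Fin n, s.arr 1 v = ((D.δ v : Fin D.m) : ℕ)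

/-- One program computes, in polynomial time, for every graph in the class `C` a branch
decomposition of mim-width at most `k`. -/
def ComputableWithin (C : ∀ {n : ℕ}, SimpleGraph (Fin n) → Prop) (k : ℕ) : Prop :=
  ∃ (p : Prog) (time : Polynomial ℕ), ∀ (n : ℕ) (G : SimpleGraph (Fin n)), C G →
    ∃ (s : State) (steps : ℕ) (D : BranchDecomposition (Fin n)),
      Exec p (inputState G) s steps ∧ steps ≤ time.eval n ∧ Holds s D ∧ D.mimw G ≤ k

end

end TreeConvex

namespace TreeConvex

universe u v

/-! ### A language of bounded loops

Expressions with bounded sums and commands with bounded loops. All loops range over the numbers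
less than a fixed number `n`, and loop variables are lexically scoped, so that the meaning of a
command is a function of the contents of the arrays. -/

/-! Root the host tree at some vertex. A deepest vertex `a` of a parent-closed set `X` can be
removed: if `b` sees `a` and another vertex of `X`, then, its neighbourhood being a subtree, `b`
also sees the parent of `a`. Hence the host side `A` is dismantlable (`Dismantlable`). This property
mentions only `G` and `A`, and it is confluent (`Dismantlable.erase`), so greedy elimination never
takes a wrong turn and the host tree need not be known.

Elimination becomes a sequence of merges (`CanMerge`): a vertex outside `A` with at most one
remaining neighbour is merged into that neighbour (into any vertex if it has none), and a vertex of
`A` is merged into a vertex of `A` that dominates it on the remaining graph. The merges form a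
binary tree on the vertices, which is the branch decomposition, and each of its cuts separates one
cluster from the rest. If the remaining vertex `v` of the cluster lies outside `A`, all crossing
edges contain `v`. If `v ∈ A`, all crossing edges join a vertex of `A` in the cluster to a neighbour
of `v` outside the cluster, so an induced matching yields vertices whose traces on the neighbourhood
of `v` are pairwise incomparable (`ClusterInv.cutMim_le`).

Such antichains are small. With the host tree rooted at `v`, a neighbour of `v` that sees `x` sees
the whole path from `x` to `v`, so traces grow towards the root and incomparable traces belong to
incomparable tree vertices. There are at most `t * Δ + 2` of these
(`IsRooted.card_le_of_incomparable`), which is at most the claimed bound.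

The algorithm does not know `A` either. In each component it tries the sides containing the various
vertices and keeps one that passes two tests: elimination succeeds, and no antichain of `k + 1`
traces exists, where `k` is the bound and is fixed. The true side passes, and any side that passes
is good enough (`den_tryVertex`). The accepted sides together form a dismantlable side of `G`, and a
final elimination builds the tree (`den_decompose`). The program is written in a language of bounded
loops whose compilation to the machine is correct and polynomial (`Cmd.exec_code`). The bound on the
mim-width is read off from the output. -/

/-- The contents of the arrays. -/
abbrev Arrays := ℕ → ℕ → ℕ

/-- Expressions with bounded sums. -/
inductive LExpr where
  | const (c : ℕ)
  | len
  | var (x : ℕ)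
  | read (a : ℕ) (i : LExpr)
  | add (e f : LExpr)
  | sub (e f : LExpr)
  | sum (x : ℕ) (e : LExpr)

/-- The value of an expression, for loops of length `n`. -/
def LExpr.eval (n : ℕ) (α : Arrays) : (ℕ → ℕ) → LExpr → ℕ
  | _, .const c => c
  | _, .len => n
  | ρ, .var x => ρ x
  | ρ, .read a i => α a (i.eval n α ρ)
  | ρ, .add e f => e.eval n α ρ + f.eval n α ρ
  | ρ, .sub e f => e.eval n α ρ - f.eval n α ρ
  | ρ, .sum x e => ∑ i ∈ Finset.range n, e.eval n α (Function.update ρ x i)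

/-- Commands with bounded loops. -/
inductive Cmd where
  | skip
  | write (a : ℕ) (i e : LExpr)
  | seq (p q : Cmd)
  | ite (e : LExpr) (p q : Cmd)
  | loop (x : ℕ) (p : Cmd)

/-- The composition of `f 0, …, f (n - 1)`. -/
def iter {S : Type*} (f : ℕ → S → S) : ℕ → S → S
  | 0, s => s
  | n + 1, s => f n (iter f n s)

lemma iter_induction {S : Type*} {f : ℕ → S → S} (I : ℕ → S → Prop) {n : ℕ} {s : S} (h₀ : I 0 s)
    (h : ∀ i < n, ∀ s, I i s → I (i + 1) (f i s)) : I n (iter f n s) := by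
  induction n with
  | zero => exact h₀
  | succ n ih => exact h n (by omega) _ (ih fun i hi => h i (by omega))

/-- Replace the entry `i` of the array `a` by `v`. -/
def Arrays.set (α : Arrays) (a i v : ℕ) : Arrays :=
  Function.update α a (Function.update (α a) i v)

lemma Arrays.set_apply (α : Arrays) (a i v b j : ℕ) :
    α.set a i v b j = if b = a ∧ j = i then v else α b j := by
  unfold Arrays.set
  by_cases hb : b = a
  · subst hb
    by_cases hj : j = i <;> simp [hj]
  · simp [hb]

/-- The meaning of a command. -/
def Cmd.den (n : ℕ) : Cmd → (ℕ → ℕ) → Arrays → Arrays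
  | .skip, _, α => α
  | .write a i e, ρ, α => α.set a (i.eval n α ρ) (e.eval n α ρ)
  | .seq p q, ρ, α => q.den n ρ (p.den n ρ α)
  | .ite e p q, ρ, α => if e.eval n α ρ ≠ 0 then p.den n ρ α else q.den n ρ α
  | .loop x p, ρ, α => iter (fun i α => p.den n (Function.update ρ x i) α) n α

lemma Cmd.den_seq (n : ℕ) (p q : Cmd) (ρ : ℕ → ℕ) (α : Arrays) :
    (Cmd.seq p q).den n ρ α = q.den n ρ (p.den n ρ α) := rfl

/-! ### Compilation of bounded loops to machine programs, with running times. -/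

/-- The register of a variable. -/
def vreg (x : ℕ) : ℕ := 2 * x + 2

/-- The register of a temporary. -/
def treg (t : ℕ) : ℕ := 2 * t + 1

/-- A loop that runs through the values of the variable `x`, with temporaries `t` and `t + 1`. -/
def forLoop (t x : ℕ) (p : Prog) : Prog :=
  .seq (.assign (treg t) (.const 0)) <|
  .seq (.assign (treg (t + 1)) (.reg (vreg x))) <|
  .seq (.loop (.sub (.reg 0) (.reg (treg t))) <|
    .seq (.assign (vreg x) (.reg (treg t))) <|
    .seq p <| .assign (treg t) (.add (.reg (treg t)) (.const 1))) <|
  .assign (vreg x) (.reg (treg (t + 1)))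

/-- A program that computes the value of an expression into the temporary `t`. -/
def LExpr.code : LExpr → ℕ → Prog
  | .const c, t => .assign (treg t) (.const c)
  | .len, t => .assign (treg t) (.reg 0)
  | .var x, t => .assign (treg t) (.reg (vreg x))
  | .read a i, t => .seq (i.code t) (.assign (treg t) (.read a (.reg (treg t))))
  | .add e f, t => .seq (e.code t) <| .seq (f.code (t + 1)) <|
      .assign (treg t) (.add (.reg (treg t)) (.reg (treg (t + 1))))
  | .sub e f, t => .seq (e.code t) <| .seq (f.code (t + 1)) <|
      .assign (treg t) (.sub (.reg (treg t)) (.reg (treg (t + 1))))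
  | .sum x e, t => .seq (.assign (treg t) (.const 0)) <|
      forLoop (t + 1) x <| .seq (e.code (t + 3)) <|
        .assign (treg t) (.add (.reg (treg t)) (.reg (treg (t + 3))))

/-- The program of a command, with temporaries from `t` on. -/
def Cmd.code : Cmd → ℕ → Prog
  | .skip, _ => .skip
  | .write a i e, t => .seq (i.code t) <| .seq (e.code (t + 1)) <|
      .write a (.reg (treg t)) (.reg (treg (t + 1)))
  | .seq p q, t => .seq (p.code t) (q.code t)
  | .ite e p q, t => .seq (e.code t) (.cond (.reg (treg t)) (p.code t) (q.code t))
  | .loop x p, t => forLoop t x (p.code (t + 2))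

noncomputable section

/-- A bound for the running time of a loop. -/
def loopTime (q : Polynomial ℕ) : Polynomial ℕ := Polynomial.X * (q + 10) + 10

/-- A bound for the running time of the program of an expression. -/
def LExpr.time : LExpr → Polynomial ℕ
  | .const _ => 2
  | .len => 2
  | .var _ => 2
  | .read _ i => i.time + 3
  | .add e f => e.time + f.time + 4
  | .sub e f => e.time + f.time + 4
  | .sum _ e => loopTime (e.time + 4) + 2

/-- A bound for the running time of the program of a command. -/
def Cmd.time : Cmd → Polynomial ℕ
  | .skip => 1
  | .write _ i e => i.time + e.time + 3
  | .seq p q => p.time + q.time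
  | .ite e p q => e.time + p.time + q.time + 2
  | .loop _ p => loopTime p.time

end

/-- The state `s` represents the arrays `α` and the variables `ρ`. -/
structure Represents (n : ℕ) (ρ : ℕ → ℕ) (α : Arrays) (s : State) : Prop where
  len : s.reg 0 = n
  var : ∀ x, s.reg (vreg x) = ρ x
  arr : s.arr = α

/-- Temporaries below `t` agree. -/
def SameBelow (t : ℕ) (s s' : State) : Prop := ∀ u < t, s'.reg (treg u) = s.reg (treg u)

lemma SameBelow.trans {t : ℕ} {s s' s'' : State} (h : SameBelow t s s') (h' : SameBelow t s' s'') :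
    SameBelow t s s'' := fun u hu => (h' u hu).trans (h u hu)

lemma SameBelow.mono {t t' : ℕ} {s s' : State} (h : SameBelow t' s s') (ht : t ≤ t') :
    SameBelow t s s' := fun u hu => h u (hu.trans_le ht)

/-- The result of assigning `v` to the register `r`. -/
def State.setReg (s : State) (r v : ℕ) : State := { s with reg := Function.update s.reg r v }

lemma exec_assign (s : State) (r : ℕ) (e : Expr) :
    Exec (.assign r e) s (s.setReg r (e.eval s)) (e.cost + 1) := Exec.assign s r e

lemma setReg_reg (s : State) (r v r' : ℕ) :
    (s.setReg r v).reg r' = if r' = r then v else s.reg r' := by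
  simp [State.setReg, Function.update_apply]

@[simp] lemma treg_inj {t u : ℕ} : treg t = treg u ↔ t = u := by unfold treg; omega
@[simp] lemma vreg_inj {t u : ℕ} : vreg t = vreg u ↔ t = u := by unfold vreg; omega
@[simp] lemma vreg_ne_treg {t u : ℕ} : vreg t ≠ treg u := by unfold treg vreg; omega
@[simp] lemma treg_ne_vreg {t u : ℕ} : treg t ≠ vreg u := by unfold treg vreg; omega
@[simp] lemma zero_ne_treg {u : ℕ} : 0 ≠ treg u := by unfold treg; omega
@[simp] lemma zero_ne_vreg {u : ℕ} : 0 ≠ vreg u := by unfold vreg; omega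

lemma Represents.set_treg {n : ℕ} {ρ : ℕ → ℕ} {α : Arrays} {s : State} (h : Represents n ρ α s)
    (t v : ℕ) : Represents n ρ α (s.setReg (treg t) v) :=
  ⟨by simp [setReg_reg, h.len], fun x => by simp [setReg_reg, h.var], h.arr⟩

lemma Represents.set_vreg {n : ℕ} {ρ : ℕ → ℕ} {α : Arrays} {s : State} (h : Represents n ρ α s)
    (x v : ℕ) : Represents n (Function.update ρ x v) α (s.setReg (vreg x) v) :=
  ⟨by simp [setReg_reg, h.len], fun y => by
    by_cases hy : y = x <;> simp [setReg_reg, hy, h.var], h.arr⟩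

lemma SameBelow.set_treg (s : State) {t u : ℕ} (h : t ≤ u) (v : ℕ) :
    SameBelow t s (s.setReg (treg u) v) := fun w hw => by
  simp [setReg_reg, show w ≠ u by omega]

lemma SameBelow.set_vreg (s : State) (t u v : ℕ) :
    SameBelow t s (s.setReg (vreg u) v) := fun w _ => by
  simp [setReg_reg]

lemma exec_loop {e : Expr} {p : Prog} {n C : ℕ} (I : ℕ → State → Prop)
    (h : ∀ i < n, ∀ s, I i s → e.eval s ≠ 0 ∧ ∃ s' k, Exec p s s' k ∧ k ≤ C ∧ I (i + 1) s')
    (hn : ∀ s, I n s → e.eval s = 0) {s : State} (h₀ : I 0 s) :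
    ∃ s' k, Exec (.loop e p) s s' k ∧ k ≤ n * (C + e.cost + 1) + (e.cost + 1) ∧ I n s' := by
  suffices H : ∀ d i s, i + d = n → I i s →
      ∃ s' k, Exec (.loop e p) s s' k ∧ k ≤ d * (C + e.cost + 1) + (e.cost + 1) ∧ I n s' from
    H n 0 s (by omega) h₀
  intro d
  induction d with
  | zero =>
    intro i s hi hs
    obtain rfl : i = n := by omega
    exact ⟨s, _, Exec.loop_false (hn s hs), by omega, hs⟩
  | succ d ih =>
    intro i s hi hs
    obtain ⟨he, s', k, hk, hkC, hs'⟩ := h i (by omega) s hs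
    obtain ⟨s'', l, hl, hlC, hs''⟩ := ih (i + 1) s' (by omega) hs'
    refine ⟨s'', _, Exec.loop_true he hk hl, ?_, hs''⟩
    rw [Nat.add_mul]
    omega

/-- Correctness of loops. The predicate `J` describes what the loop body does besides running
through the values of `x`. -/
lemma exec_forLoop {n t x C : ℕ} {p : Prog} {ρ : ℕ → ℕ} (α : ℕ → Arrays) (J : ℕ → State → Prop)
    (hJ : ∀ i s u v, t ≤ u → u ≤ t + 1 → J i s → J i (s.setReg (treg u) v))
    (hJ' : ∀ i s u v, J i s → J i (s.setReg (vreg u) v))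
    (h : ∀ i < n, ∀ s, Represents n (Function.update ρ x i) (α i) s → J i s →
      ∃ s' k, Exec p s s' k ∧ k ≤ C ∧ Represents n (Function.update ρ x i) (α (i + 1)) s' ∧
        J (i + 1) s' ∧ s'.reg (treg t) = s.reg (treg t) ∧
        s'.reg (treg (t + 1)) = s.reg (treg (t + 1)))
    {s : State} (hs : Represents n ρ (α 0) s) (hs₀ : J 0 s) :
    ∃ s' k, Exec (forLoop t x p) s s' k ∧ k ≤ n * (C + 10) + 10 ∧ Represents n ρ (α n) s' ∧
      J n s' := by
  obtain ⟨s', k, hk, hkC, hr, hj, hc, hv⟩ := exec_loop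
    (e := .sub (.reg 0) (.reg (treg t)))
    (p := .seq (.assign (vreg x) (.reg (treg t))) <|
      .seq p <| .assign (treg t) (.add (.reg (treg t)) (.const 1))) (n := n) (C := C + 6)
    -- The counter lives in temporary `t`, and temporary `t + 1` keeps the outer value of `x`. The
    -- value of `x` itself is irrelevant between rounds, hence the existential.
    (I := fun i s => (∃ v, Represents n (Function.update ρ x v) (α i) s) ∧ J i s ∧
      s.reg (treg t) = i ∧ s.reg (treg (t + 1)) = ρ x)
    (s := (s.setReg (treg t) 0).setReg (treg (t + 1)) (ρ x)) (by
      rintro i hi s ⟨⟨v, hv⟩, hj, hc, hsv⟩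
      refine ⟨by simp [Expr.eval, hv.len, hc]; omega, ?_⟩
      have hr := hv.set_vreg x i
      rw [Function.update_idem] at hr
      obtain ⟨s', k, hk, hkC, hr', hj', hb, hb'⟩ := h i hi _ hr (hJ' _ _ _ _ hj)
      refine ⟨_, _, Exec.seq (exec_assign _ _ _) (Exec.seq (k := k) ?_ (exec_assign _ _ _)), ?_,
        ⟨_, hr'.set_treg _ _⟩, hJ _ _ _ _ le_rfl (by omega) hj', ?_, ?_⟩
      · simpa [Expr.eval, hc] using hk
      · simp [Expr.cost]; omega
      · simp [setReg_reg, Expr.eval, hb, hc]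
      · simp [setReg_reg, hb', hsv]) (by
      rintro s ⟨⟨v, hv⟩, hj, hc, hsv⟩
      simp [Expr.eval, hv.len, hc]) (by
      refine ⟨⟨ρ x, ?_⟩, hJ _ _ _ _ (by omega) (by omega) (hJ _ _ _ _ (by omega) (by omega) hs₀),
        by simp [setReg_reg], by simp [setReg_reg]⟩
      rw [Function.update_eq_self]
      exact (hs.set_treg _ _).set_treg _ _)
  obtain ⟨v, hr⟩ := hr
  have hk' : Exec (forLoop t x p) s (s'.setReg (vreg x) (ρ x)) _ :=
    Exec.seq (exec_assign _ _ _) (Exec.seq (s' := (s.setReg (treg t) 0).setReg (treg (t + 1)) (ρ x))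
      (k := 2) (by
        have := exec_assign (s.setReg (treg t) 0) (treg (t + 1)) (.reg (vreg x))
        simpa [Expr.eval, Expr.cost, setReg_reg, hs.var] using this)
      (Exec.seq hk (by
        have := exec_assign s' (vreg x) (.reg (treg (t + 1)))
        simp only [Expr.eval, hv] at this
        exact this)))
  refine ⟨_, _, hk', ?_, ?_, hJ' _ _ _ _ hj⟩
  · simp only [Expr.cost] at hkC ⊢
    nlinarith
  · have := hr.set_vreg x (ρ x)
    rwa [Function.update_idem, Function.update_eq_self] at this

/-- Temporaries work as a stack: code started at level `t` leaves everything below `t` untouched.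
The value of a first operand thus survives the evaluation of the second at level `t + 1`. -/
lemma LExpr.exec_code (n : ℕ) (α : Arrays) (e : LExpr) : ∀ (t : ℕ) (ρ : ℕ → ℕ) (s : State),
    Represents n ρ α s → ∃ s' k, Exec (e.code t) s s' k ∧ k ≤ e.time.eval n ∧
      Represents n ρ α s' ∧ SameBelow t s s' ∧ s'.reg (treg t) = e.eval n α ρ := by
  induction e with
  | const c =>
    intro t ρ s hs
    exact ⟨_, _, exec_assign _ _ _, by simp [Expr.cost, time], hs.set_treg _ _,
      SameBelow.set_treg _ le_rfl _, by simp [setReg_reg, Expr.eval, eval]⟩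
  | len =>
    intro t ρ s hs
    exact ⟨_, _, exec_assign _ _ _, by simp [Expr.cost, time], hs.set_treg _ _,
      SameBelow.set_treg _ le_rfl _, by simp [setReg_reg, Expr.eval, eval, hs.len]⟩
  | var x =>
    intro t ρ s hs
    exact ⟨_, _, exec_assign _ _ _, by simp [Expr.cost, time], hs.set_treg _ _,
      SameBelow.set_treg _ le_rfl _, by simp [setReg_reg, Expr.eval, eval, hs.var]⟩
  | read a i ih =>
    intro t ρ s hs
    obtain ⟨s', k, hk, hkC, hr, hb, hv⟩ := ih t ρ s hs
    exact ⟨_, _, Exec.seq hk (exec_assign _ _ _), by simp [Expr.cost, time]; omega,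
      hr.set_treg _ _, hb.trans (SameBelow.set_treg _ le_rfl _),
      by simp [setReg_reg, Expr.eval, eval, hv, hr.arr]⟩
  | add e f ihe ihf =>
    intro t ρ s hs
    obtain ⟨s', k, hk, hkC, hr, hb, hv⟩ := ihe t ρ s hs
    obtain ⟨s'', l, hl, hlC, hr', hb', hv'⟩ := ihf (t + 1) ρ s' hr
    refine ⟨_, _, Exec.seq hk (Exec.seq hl (exec_assign _ _ _)),
      by simp [Expr.cost, time]; omega,
      hr'.set_treg _ _, (hb.trans (hb'.mono (by omega))).trans (SameBelow.set_treg _ le_rfl _), ?_⟩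
    simp [setReg_reg, Expr.eval, eval, hv', hb' t (by omega), hv]
  | sub e f ihe ihf =>
    intro t ρ s hs
    obtain ⟨s', k, hk, hkC, hr, hb, hv⟩ := ihe t ρ s hs
    obtain ⟨s'', l, hl, hlC, hr', hb', hv'⟩ := ihf (t + 1) ρ s' hr
    refine ⟨_, _, Exec.seq hk (Exec.seq hl (exec_assign _ _ _)),
      by simp [Expr.cost, time]; omega,
      hr'.set_treg _ _, (hb.trans (hb'.mono (by omega))).trans (SameBelow.set_treg _ le_rfl _), ?_⟩
    simp [setReg_reg, Expr.eval, eval, hv', hb' t (by omega), hv]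
  | sum x e ih =>
    intro t ρ s hs
    -- Temporary `t` accumulates the sum, `t + 1` and `t + 2` serve the loop, and the summand is
    -- computed from `t + 3` on.
    obtain ⟨s', k, hk, hkC, hr, hb, hv⟩ := exec_forLoop (n := n) (t := t + 1) (x := x)
      (C := e.time.eval n + 4) (ρ := ρ)
      (p := .seq (e.code (t + 3)) <|
        .assign (treg t) (.add (.reg (treg t)) (.reg (treg (t + 3)))))
      (fun _ => α)
      (fun i s' => SameBelow t s s' ∧
        s'.reg (treg t) = ∑ j ∈ Finset.range i, e.eval n α (Function.update ρ x j))
      (fun i s' u v hu _ h => ⟨h.1.trans (SameBelow.set_treg _ (by omega) _),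
        by simp [setReg_reg, show t ≠ u by omega, h.2]⟩)
      (fun i s' u v h => ⟨h.1.trans (SameBelow.set_vreg _ _ _ _), by simp [setReg_reg, h.2]⟩)
      (by
        rintro i hi s₁ hr ⟨hb₁, hv₁⟩
        obtain ⟨s₂, k, hk, hkC, hr₂, hb₂, hv₂⟩ := ih (t + 3) _ s₁ hr
        refine ⟨_, _, Exec.seq hk (exec_assign _ _ _), by simp [Expr.cost]; omega,
          hr₂.set_treg _ _, ⟨(hb₁.trans (hb₂.mono (by omega))).trans
            (SameBelow.set_treg _ le_rfl _), ?_⟩,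
          by simp [setReg_reg, hb₂ (t + 1) (by omega)], by
            simp [setReg_reg, hb₂ (t + 2) (by omega), show t + 1 + 1 ≠ t by omega]⟩
        simp [setReg_reg, Expr.eval, hb₂ t (by omega), hv₁, hv₂, Finset.sum_range_succ])
      (s := s.setReg (treg t) 0) (hs.set_treg _ _)
      ⟨SameBelow.set_treg _ le_rfl _, by simp [setReg_reg]⟩
    refine ⟨s', _, Exec.seq (exec_assign _ _ _) hk, ?_, hr, hb, hv⟩
    simp [Expr.cost, time, loopTime]
    omega

lemma Cmd.exec_code (n : ℕ) (p : Cmd) : ∀ (t : ℕ) (ρ : ℕ → ℕ) (α : Arrays) (s : State),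
    Represents n ρ α s → ∃ s' k, Exec (p.code t) s s' k ∧ k ≤ p.time.eval n ∧
      Represents n ρ (p.den n ρ α) s' ∧ SameBelow t s s' := by
  induction p with
  | skip =>
    intro t ρ α s hs
    exact ⟨s, 1, Exec.skip s, by simp [time], hs, fun _ _ => rfl⟩
  | write a i e =>
    intro t ρ α s hs
    obtain ⟨s', k, hk, hkC, hr, hb, hv⟩ := i.exec_code n α t ρ s hs
    obtain ⟨s'', l, hl, hlC, hr', hb', hv'⟩ := e.exec_code n α (t + 1) ρ s' hr
    refine ⟨_, _, Exec.seq hk (Exec.seq hl (Exec.write _ _ _ _)), by simp [Expr.cost, time]; omega,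
      ⟨hr'.len, hr'.var, ?_⟩, hb.trans (hb'.mono (by omega))⟩
    simp [Expr.eval, hv', hb' t (by omega), hv, hr'.arr, den, Arrays.set]
  | seq p q ihp ihq =>
    intro t ρ α s hs
    obtain ⟨s', k, hk, hkC, hr, hb⟩ := ihp t ρ α s hs
    obtain ⟨s'', l, hl, hlC, hr', hb'⟩ := ihq t ρ _ s' hr
    exact ⟨_, _, Exec.seq hk hl, by simp [time]; omega, hr', hb.trans hb'⟩
  | ite e p q ihp ihq =>
    intro t ρ α s hs
    obtain ⟨s', k, hk, hkC, hr, hb, hv⟩ := e.exec_code n α t ρ s hs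
    by_cases he : e.eval n α ρ ≠ 0
    · obtain ⟨s'', l, hl, hlC, hr', hb'⟩ := ihp t ρ _ s' hr
      refine ⟨_, _, Exec.seq hk (Exec.cond_true (by simpa [Expr.eval, hv] using he) hl),
        by simp [time, Expr.cost]; omega, ?_, hb.trans hb'⟩
      simpa only [den, if_pos he] using hr'
    · obtain ⟨s'', l, hl, hlC, hr', hb'⟩ := ihq t ρ _ s' hr
      refine ⟨_, _, Exec.seq hk (Exec.cond_false (by simpa [Expr.eval, hv] using he) hl),
        by simp [time, Expr.cost]; omega, ?_, hb.trans hb'⟩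
      simpa only [den, if_neg he] using hr'
  | loop x p ih =>
    intro t ρ α s hs
    obtain ⟨s', k, hk, hkC, hr, hb⟩ := exec_forLoop (n := n) (t := t) (x := x)
      (C := p.time.eval n) (ρ := ρ) (p := p.code (t + 2))
      (fun j => iter (fun i α => p.den n (Function.update ρ x i) α) j α)
      (fun i s' => SameBelow t s s')
      (fun i s' u v hu _ h => h.trans (SameBelow.set_treg _ (by omega) _))
      (fun i s' u v h => h.trans (SameBelow.set_vreg _ _ _ _))
      (fun i hi s₁ hr hb => by
        obtain ⟨s₂, k, hk, hkC, hr₂, hb₂⟩ := ih (t + 2) _ _ s₁ hr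
        exact ⟨s₂, k, hk, hkC, hr₂, hb.trans (hb₂.mono (by omega)), hb₂ t (by omega),
          hb₂ (t + 1) (by omega)⟩)
      hs (fun _ _ => rfl)
    exact ⟨s', k, hk, by simpa [time, loopTime] using hkC, hr, hb⟩

section Dismantling

variable {V : Type u} {G : SimpleGraph V}

/-! ### Dismantlable sets -/

/-- The vertex `a` can be removed from `X` in favour of `a'`: every vertex adjacent to `a` and to a
further vertex of `X` is adjacent to `a'`. -/
def Reducible (G : SimpleGraph V) (X : Finset V) (a a' : V) : Prop :=
  ∀ b, G.Adj b a → (∃ x ∈ X, x ≠ a ∧ G.Adj b x) → G.Adj b a'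

lemma Reducible.mono {X Y : Finset V} {a a' : V} (h : Reducible G X a a') (hY : Y ⊆ X) :
    Reducible G Y a a' := fun b hb ⟨x, hx, hxa, hbx⟩ => h b hb ⟨x, hY hx, hxa, hbx⟩

variable [DecidableEq V]

/-- The set `X` can be reduced to at most one vertex. -/
inductive Dismantlable (G : SimpleGraph V) : Finset V → Prop
  | base {X : Finset V} : X.card ≤ 1 → Dismantlable G X
  | step {X : Finset V} {a a' : V} : a ∈ X → a' ∈ X → a ≠ a' → Reducible G X a a' →
      Dismantlable G (X.erase a) → Dismantlable G X

/-- The two hypotheses make `a` and `c` twins: a vertex that sees one of them and something in `Y`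
sees the other as well. A dismantling that uses `c` can therefore be replayed with `a` in its place.
-/
lemma Dismantlable.swap {Y : Finset V} {a c : V} (hac : a ≠ c) (ha : a ∉ Y) (hc : c ∉ Y)
    (h₁ : Reducible G (insert a (insert c Y)) a c) (h₂ : Reducible G (insert a (insert c Y)) c a)
    (h : Dismantlable G (insert c Y)) : Dismantlable G (insert a Y) := by
  generalize hX : insert c Y = X at h
  induction h generalizing Y with
  | base h =>
    subst hX
    refine .base ?_
    rw [Finset.card_insert_of_notMem ha]
    rwa [Finset.card_insert_of_notMem hc] at h
  | @step X e e' he he' hee hr hd ih =>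
    subst hX
    by_cases hec : e = c
    · subst hec
      have he'Y : e' ∈ Y := (Finset.mem_insert.1 he').resolve_left (Ne.symm hee)
      refine .step (a := a) (a' := e') (Finset.mem_insert_self _ _)
        (Finset.mem_insert_of_mem he'Y) (by rintro rfl; exact ha he'Y) ?_ ?_
      · rintro b hb ⟨x, hx, hxa, hbx⟩
        have hxY : x ∈ Y := (Finset.mem_insert.1 hx).resolve_left hxa
        have hbe : G.Adj b e := h₁ b hb ⟨x, by simp [hxY], hxa, hbx⟩
        exact hr b hbe ⟨x, by simp [hxY], by rintro rfl; exact hc hxY, hbx⟩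
      · rw [Finset.erase_insert hc] at hd
        rwa [Finset.erase_insert ha]
    · have heY : e ∈ Y := (Finset.mem_insert.1 he).resolve_left hec
      have hea : e ≠ a := by rintro rfl; exact ha heY
      -- If the further vertex seen by `b` is `a`, then `b` also sees `c`, because it sees `e ∈ Y`;
      -- so the original reduction of `e` applies.
      have key : ∀ b, G.Adj b e → (∃ x ∈ insert a Y, x ≠ e ∧ G.Adj b x) → G.Adj b e' := by
        rintro b hb ⟨x, hx, hxe, hbx⟩
        by_cases hxa : x = a
        · subst hxa
          have : G.Adj b c := h₁ b hbx ⟨e, by simp [heY], hea, hb⟩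
          exact hr b hb ⟨c, by simp, Ne.symm hec, this⟩
        · have hxY : x ∈ Y := (Finset.mem_insert.1 hx).resolve_left hxa
          exact hr b hb ⟨x, by simp [hxY], hxe, hbx⟩
      have hd' : Dismantlable G (insert a (Y.erase e)) := by
        refine ih (by simp [ha]) (by simp [hc]) (h₁.mono ?_) (h₂.mono ?_) ?_
        · exact Finset.insert_subset_insert _ (Finset.insert_subset_insert _
            (Finset.erase_subset _ _))
        · exact Finset.insert_subset_insert _ (Finset.insert_subset_insert _
            (Finset.erase_subset _ _))
        · rw [Finset.erase_insert_of_ne (Ne.symm hec)]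
      rw [← Finset.erase_insert_of_ne (Ne.symm hea)] at hd'
      by_cases he'c : e' = c
      · subst he'c
        refine .step (a := e) (a' := a) (by simp [heY]) (by simp) hea ?_ hd'
        intro b hb hx
        have := key b hb hx
        exact h₂ b this ⟨e, by simp [heY], hec, hb⟩
      · exact .step (a := e) (a' := e') (by simp [heY])
          (Finset.mem_insert_of_mem ((Finset.mem_insert.1 he').resolve_left he'c)) hee key hd'

/-- Confluence: every possible reduction of a dismantlable set leads to a dismantlable set. -/
lemma Dismantlable.erase {X : Finset V} (h : Dismantlable G X) {c c' : V} (hc : c ∈ X)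
    (hc' : c' ∈ X) (hcc : c ≠ c') (hr : Reducible G X c c') : Dismantlable G (X.erase c) := by
  induction h generalizing c c' with
  | @base X h => exact .base ((Finset.card_le_card (Finset.erase_subset _ _)).trans h)
  | @step X a a' ha ha' haa hra hd ih =>
    by_cases hac : a = c
    · subst hac; exact hd
    by_cases hc'a : c' = a
    · subst hc'a
      by_cases ha'c : a' = c
      · subst ha'c
        have hY : ∀ x ∈ X, x = c' ∨ x = a' ∨ x ∈ (X.erase a').erase c' := fun x hx => by
          by_cases h1 : x = c' <;> by_cases h2 : x = a' <;> simp [h1, h2, hx]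
        have e1 : insert c' ((X.erase a').erase c') = X.erase a' :=
          Finset.insert_erase (by simp [hac, ha])
        have e2 : insert a' ((X.erase a').erase c') = X.erase c' := by
          rw [Finset.erase_right_comm]
          exact Finset.insert_erase (by simp [hcc, ha'])
        have e3 : insert c' (insert a' ((X.erase a').erase c')) = X := by
          rw [e2]; exact Finset.insert_erase ha
        rw [← e1]
        exact Dismantlable.swap (c := a') hac (by simp) (by simp) (by rwa [e3]) (by rwa [e3])
          (by rwa [e2])
      · have h1 : Reducible G (X.erase c') c a' := by
          rintro b hb ⟨x, hx, hxc, hbx⟩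
          have hbc' := hr b hb ⟨x, Finset.mem_of_mem_erase hx, hxc, hbx⟩
          exact hra b hbc' ⟨c, hc, hcc, hb⟩
        have := ih (Finset.mem_erase.2 ⟨hcc, hc⟩) (Finset.mem_erase.2 ⟨Ne.symm haa, ha'⟩)
          (Ne.symm ha'c) h1
        rw [Finset.erase_right_comm] at this
        exact .step (Finset.mem_erase.2 ⟨hac, ha⟩) (Finset.mem_erase.2 ⟨ha'c, ha'⟩) haa
          (hra.mono (Finset.erase_subset _ _)) this
    · have := ih (Finset.mem_erase.2 ⟨Ne.symm hac, hc⟩) (Finset.mem_erase.2 ⟨hc'a, hc'⟩) hcc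
        (hr.mono (Finset.erase_subset _ _))
      rw [Finset.erase_right_comm] at this
      -- The two removals commute, except that when `a` was to be removed in favour of `c`, it is
      -- now removed in favour of `c'`.
      by_cases ha'c : a' = c
      · subst ha'c
        refine .step (a' := c') (Finset.mem_erase.2 ⟨hac, ha⟩)
          (Finset.mem_erase.2 ⟨Ne.symm hcc, hc'⟩) (Ne.symm hc'a) ?_ this
        rintro b hb ⟨x, hx, hxa, hbx⟩
        have := hra b hb ⟨x, Finset.mem_of_mem_erase hx, hxa, hbx⟩
        exact hr b this ⟨a, ha, hac, hb⟩
      · exact .step (Finset.mem_erase.2 ⟨hac, ha⟩) (Finset.mem_erase.2 ⟨ha'c, ha'⟩) haa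
          (hra.mono (Finset.erase_subset _ _)) this

lemma dismantlable_erase_iff {X : Finset V} {c c' : V} (hc : c ∈ X)
    (hc' : c' ∈ X) (hcc : c ≠ c') (hr : Reducible G X c c') :
    Dismantlable G (X.erase c) ↔ Dismantlable G X :=
  ⟨fun h => .step hc hc' hcc hr h, fun h => h.erase hc hc' hcc hr⟩

/-- The intersection of a dismantlable set with a union of components is dismantlable. -/
lemma Dismantlable.filter {X : Finset V} (h : Dismantlable G X) (p : V → Prop) [DecidablePred p]
    (hp : ∀ x y, p x → G.Adj x y → p y) : Dismantlable G (X.filter p) := by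
  induction h with
  | base h => exact .base ((Finset.card_filter_le _ _).trans h)
  | @step X a a' ha ha' haa hra hd ih =>
    rw [Finset.filter_erase] at ih
    by_cases hpa : p a
    · by_cases hpa' : p a'
      · exact .step (Finset.mem_filter.2 ⟨ha, hpa⟩) (Finset.mem_filter.2 ⟨ha', hpa'⟩) haa
          (hra.mono (Finset.filter_subset _ _)) ih
      -- With `a'` in other components, no neighbour of `a` sees any further vertex of `X`: it would
      -- have to see `a'`. So `a` reduces vacuously to any other vertex of the filtered set.
      · by_cases hcard : (X.filter p).card ≤ 1
        · exact .base hcard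
        · obtain ⟨c, hc, hca⟩ := Finset.exists_mem_ne (not_le.1 hcard) a
          refine .step (Finset.mem_filter.2 ⟨ha, hpa⟩) hc (Ne.symm hca) ?_ ih
          rintro b hb ⟨x, hx, hxa, hbx⟩
          have := hra b hb ⟨x, (Finset.mem_filter.1 hx).1, hxa, hbx⟩
          exact absurd (hp _ _ (hp _ _ hpa hb.symm) this) hpa'
    · rwa [Finset.erase_eq_of_notMem (by simp [hpa])] at ih

/-- The union of two dismantlable sets without common neighbours is dismantlable. -/
lemma Dismantlable.union {X Y : Finset V} (hX : Dismantlable G X) (hY : Dismantlable G Y)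
    (hd : Disjoint X Y) (h : ∀ x ∈ X, ∀ y ∈ Y, ∀ b, G.Adj b x → ¬ G.Adj b y) :
    Dismantlable G (X ∪ Y) := by
  induction hX with
  | @base X hX =>
    obtain rfl | ⟨x, rfl⟩ : X = ∅ ∨ ∃ x, X = {x} := by
      rcases Nat.le_one_iff_eq_zero_or_eq_one.1 hX with h0 | h1
      · exact Or.inl (Finset.card_eq_zero.1 h0)
      · exact Or.inr (Finset.card_eq_one.1 h1)
    · simpa using hY
    · obtain rfl | ⟨y, hy⟩ := Y.eq_empty_or_nonempty
      · exact .base (by simp)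
      · have hx : x ∉ Y := by simpa using hd
        refine .step (a := x) (a' := y) (by simp) (by simp [hy]) (by rintro rfl; exact hx hy) ?_ ?_
        · rintro b hb ⟨z, hz, hzx, hbz⟩
          have hzY : z ∈ Y := by simpa [hzx] using hz
          exact absurd hbz (h x (by simp) z hzY b hb)
        · have : ({x} ∪ Y).erase x = Y := by
            rw [← Finset.insert_eq, Finset.erase_insert hx]
          rwa [this]
  | @step X a a' ha ha' haa hra _ ih =>
    have hd' := ih (hd.mono_left (Finset.erase_subset _ _))
      fun x hx => h x (Finset.mem_of_mem_erase hx)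
    refine .step (a := a) (a' := a') (by simp [ha]) (by simp [ha']) haa ?_ ?_
    · rintro b hb ⟨x, hx, hxa, hbx⟩
      rcases Finset.mem_union.1 hx with hx | hx
      · exact hra b hb ⟨x, hx, hxa, hbx⟩
      · exact absurd hbx (h a ha x hx b hb)
    · have haY : a ∉ Y := Finset.disjoint_left.1 hd ha
      rwa [Finset.erase_union_distrib, Finset.erase_eq_of_notMem haY]

/-! ### Antichains of traces -/

/-- The neighbourhoods of distinct vertices of `K` within the neighbourhood of `r` are
incomparable. -/
def IsTraceAntichain (G : SimpleGraph V) (r : V) (K : Finset V) : Prop :=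
  ∀ x ∈ K, ∀ y ∈ K, x ≠ y → ∃ b, G.Adj r b ∧ G.Adj b x ∧ ¬ G.Adj b y

/-- The traces on the neighbourhood of `r` have width at most `k`. -/
def TraceWidthLE (G : SimpleGraph V) (k : ℕ) (r : V) : Prop :=
  ∀ K : Finset V, IsTraceAntichain G r K → K.card ≤ k

/-! ### The merging process -/

/-- The vertex `u` may be merged into `v` when `R` is the set of remaining vertices and `A` is the
side of the vertices of the host tree. -/
structure CanMerge (G : SimpleGraph V) (A R : Finset V) (u v : V) : Prop where
  left : u ∈ R
  right : v ∈ R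
  ne : u ≠ v
  mem : u ∈ A → v ∈ A
  dom : u ∈ A → ∀ z ∈ R, G.Adj u z → G.Adj v z
  pendant : u ∉ A → ∀ z ∈ R, G.Adj u z → z = v

/-- The invariant of the merging process, started with the set `R₀` of vertices. -/
structure MergeInv (G : SimpleGraph V) (A R₀ R : Finset V) : Prop where
  subset : R ⊆ R₀
  nonempty : R.Nonempty
  pendant : ∀ b ∈ R₀, b ∉ R → b ∉ A → ∀ x ∈ R, ∀ y ∈ R, G.Adj b x → G.Adj b y → x = y
  dismantlable_iff : Dismantlable G (R ∩ A) ↔ Dismantlable G (R₀ ∩ A)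

/-- The set `R₀` is a union of components on which `A` is one side of a bipartition. -/
structure IsSide (G : SimpleGraph V) (A R₀ : Finset V) : Prop where
  closed : ∀ x ∈ R₀, ∀ y, G.Adj x y → y ∈ R₀
  cross : ∀ x ∈ R₀, ∀ y, G.Adj x y → (x ∈ A ↔ y ∉ A)

lemma mergeInv_refl {A R₀ : Finset V} (h : R₀.Nonempty) : MergeInv G A R₀ R₀ :=
  ⟨subset_rfl, h, fun _ h h' => absurd h h', Iff.rfl⟩

/-- Removed vertices outside `A` see at most one remaining vertex, so they impose no condition on
reducibility. Domination over the remaining graph is therefore a genuine reduction in `R ∩ A`, and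
confluence makes its removal neutral for dismantlability. -/
lemma MergeInv.erase {A R₀ R : Finset V} (h : MergeInv G A R₀ R) (hs : IsSide G A R₀) {u v : V}
    (huv : CanMerge G A R u v) : MergeInv G A R₀ (R.erase u) := by
  refine ⟨(Finset.erase_subset _ _).trans h.subset, ⟨v, by simp [huv.right, Ne.symm huv.ne]⟩,
    fun b hb hbR hbA x hx y hy hbx hby => ?_, ?_⟩
  · rw [Finset.mem_erase] at hx hy
    by_cases hbu : b = u
    · subst hbu
      rw [huv.pendant hbA x hx.2 hbx, huv.pendant hbA y hy.2 hby]
    · exact h.pendant b hb (fun hb' => hbR (by simp [hb', hbu])) hbA x hx.2 y hy.2 hbx hby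
  · rw [← h.dismantlable_iff]
    by_cases hu : u ∈ A
    · rw [Finset.erase_inter]
      refine dismantlable_erase_iff (c' := v) (by simp [hu, huv.left])
        (by simp [huv.mem hu, huv.right]) huv.ne ?_
      rintro b hb ⟨x, hx, hxu, hbx⟩
      rw [Finset.mem_inter] at hx
      have hbR₀ := hs.closed _ (h.subset huv.left) _ hb.symm
      by_cases hbR : b ∈ R
      · exact (huv.dom hu b hbR hb.symm).symm
      · exact absurd (h.pendant b hbR₀ hbR ((hs.cross _ (h.subset huv.left) _ hb.symm).1 hu)
          x hx.1 u huv.left hbx hb) hxu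
    · rw [Finset.erase_inter, Finset.erase_eq_of_notMem (by simp [hu])]

/-- The process is not stuck as long as the remaining part is dismantlable. -/
lemma MergeInv.exists_canMerge {A R₀ R : Finset V} (h : MergeInv G A R₀ R) (hs : IsSide G A R₀)
    (hd : Dismantlable G (R₀ ∩ A)) (hR : 1 < R.card) : ∃ u v, CanMerge G A R u v := by
  rw [← h.dismantlable_iff] at hd
  by_cases hb : ∃ b ∈ R, b ∉ A ∧ ∀ x ∈ R, ∀ y ∈ R, G.Adj b x → G.Adj b y → x = y
  · obtain ⟨b, hbR, hbA, hb⟩ := hb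
    by_cases hx : ∃ x ∈ R, G.Adj b x
    · obtain ⟨x, hxR, hbx⟩ := hx
      exact ⟨b, x, hbR, hxR, hbx.ne, fun h => absurd h hbA, fun h => absurd h hbA,
        fun _ z hz hbz => hb z hz x hxR hbz hbx⟩
    · obtain ⟨x, hxR, hxb⟩ := Finset.exists_mem_ne hR b
      exact ⟨b, x, hbR, hxR, Ne.symm hxb, fun h => absurd h hbA, fun h => absurd h hbA,
        fun _ z hz hbz => absurd ⟨z, hz, hbz⟩ hx⟩
  -- Now every remaining vertex outside `A` has two remaining neighbours. The side condition in
  -- `Reducible` is then automatic, so a dismantling step is a domination in the sense of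
  -- `CanMerge`.
  · push Not at hb
    have two : ∀ b ∈ R, b ∉ A → ∀ a, ∃ x ∈ R ∩ A, x ≠ a ∧ G.Adj b x := by
      intro b hbR hbA a
      obtain ⟨x, hx, y, hy, hbx, hby, hxy⟩ := hb b hbR hbA
      have side : ∀ z, G.Adj b z → z ∈ A := fun z hz => by
        by_contra hzA
        exact hbA ((hs.cross b (h.subset hbR) z hz).2 hzA)
      by_cases hxa : x = a
      · exact ⟨y, by simp [hy, side y hby], by rintro rfl; exact hxy hxa, hby⟩
      · exact ⟨x, by simp [hx, side x hbx], hxa, hbx⟩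
    cases hd with
    | base hd =>
      -- With at most one vertex left in `R ∩ A`, no remaining vertex outside `A` can have two
      -- neighbours. Hence `R ⊆ A`, and `R` has at most one vertex.
      exfalso
      obtain ⟨b, hbR, hbA⟩ : ∃ b ∈ R, b ∉ A := by
        by_contra! hcon
        rw [Finset.inter_eq_left.2 hcon] at hd
        omega
      obtain ⟨x, hx, -⟩ := two b hbR hbA b
      obtain ⟨y, hy, hyx, -⟩ := two b hbR hbA x
      exact hyx (Finset.card_le_one.1 hd y hy x hx)
    | @step _ a a' ha ha' haa hra _ =>
      rw [Finset.mem_inter] at ha ha'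
      refine ⟨a, a', ha.1, ha'.1, haa, fun _ => ha'.2, fun _ z hz haz => ?_,
        fun h => absurd ha.2 h⟩
      exact (hra z haz.symm (two z hz ((hs.cross a (h.subset ha.1) z haz).1 ha.2) a)).symm

end Dismantling

/-! ### Cuts of clusters -/

section Clusters

variable {V : Type u} {G : SimpleGraph V}

lemma cutMim_compl (X : Set V) : cutMim G Xᶜ = cutMim G X := by
  unfold cutMim
  rw [compl_compl, SimpleGraph.between_comm]

/-- The clusters of the merging process: `rep x` is the remaining vertex into which `x` has been
merged. All edges between different clusters lead to a remaining vertex outside of `A`. -/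
structure ClusterInv (G : SimpleGraph V) (A R : Finset V) (rep : V → V) : Prop where
  rep_mem : ∀ x, rep x ∈ R
  rep_self : ∀ x ∈ R, rep x = x
  edge : ∀ a ∈ A, ∀ b, b ∉ A → G.Adj a b → rep a ≠ rep b → b ∈ R ∧ rep a ∈ A ∧ G.Adj (rep a) b

lemma clusterInv_id [Fintype V] (A : Finset V) : ClusterInv G A Finset.univ id :=
  ⟨fun _ => Finset.mem_univ _, fun _ _ => rfl, fun _ ha _ _ hab _ =>
    ⟨Finset.mem_univ _, ha, hab⟩⟩

variable [DecidableEq V]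

/-- If `u` lies outside `A`, its crossing edges lead to the cluster of its only remaining neighbour
`v` and become internal. If `u ∈ A`, its representative changes to `v`, which by domination sees the
same remaining vertices outside `A`. -/
lemma ClusterInv.merge {A R : Finset V} {rep : V → V} (h : ClusterInv G A R rep) {u v : V}
    (huv : CanMerge G A R u v) :
    ClusterInv G A (R.erase u) fun x => if rep x = u then v else rep x := by
  refine ⟨fun x => ?_, fun x hx => ?_, fun a ha b hb hab hne => ?_⟩
  · split_ifs with hx
    · simp [huv.right, Ne.symm huv.ne]
    · simp [hx, h.rep_mem x]
  · rw [Finset.mem_erase] at hx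
    simp [h.rep_self x hx.2, hx.1]
  · have hne' : rep a ≠ rep b := fun he => hne (by simp [he])
    obtain ⟨hbR, haA, hadj⟩ := h.edge a ha b hb hab hne'
    have hbb := h.rep_self b hbR
    by_cases hbu : b = u
    · subst hbu
      have := huv.pendant hb (rep a) (h.rep_mem a) hadj.symm
      rw [this, hbb] at hne
      simp [Ne.symm huv.ne] at hne
    · refine ⟨by simp [hbu, hbR], ?_⟩
      by_cases hau : rep a = u
      · rw [hau] at haA hadj
        simp only [hau, if_true]
        exact ⟨huv.mem haA, huv.dom haA b hbR hadj⟩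
      · simp only [hau, if_false]
        exact ⟨haA, hadj⟩

/-- For `v ∈ A`, a crossing edge has its `A`-end in the cluster and its other end in the
neighbourhood of `v`. The `A`-ends of an induced matching thus have incomparable traces, each edge
supplying the witness for its own end. For `v ∉ A`, all crossing edges share the endpoint `v`. -/
lemma ClusterInv.cutMim_le [Finite V] {A R : Finset V} {rep : V → V} (h : ClusterInv G A R rep)
    (hA : ∀ x y, G.Adj x y → (x ∈ A ↔ y ∉ A)) {k : ℕ} (hk : 1 ≤ k) {v : V} (hv : v ∈ R)
    (hw : v ∈ A → TraceWidthLE G k v) : cutMim G {x | rep x = v} ≤ k := by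
  classical
  have cross : ∀ e ∈ (G.between {x | rep x = v} {x | rep x = v}ᶜ).edgeSet,
      ∃ a b, e = s(a, b) ∧ a ∈ A ∧ b ∉ A ∧ G.Adj a b ∧
        ((v ∈ A ∧ G.Adj v b ∧ rep a = v ∧ rep b ≠ v) ∨ (v ∉ A ∧ b = v)) := by
    intro e
    induction e using Sym2.ind with
    | _ x y =>
      rw [SimpleGraph.mem_edgeSet, SimpleGraph.between_adj]
      rintro ⟨hxy, hc⟩
      have key : ∀ a b, a ∈ A → b ∉ A → G.Adj a b → rep a ≠ rep b → (rep a = v ∨ rep b = v) →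
          (v ∈ A ∧ G.Adj v b ∧ rep a = v ∧ rep b ≠ v) ∨ (v ∉ A ∧ b = v) := by
        intro a b ha hb hab hne hor
        obtain ⟨hbR, haA, hadj⟩ := h.edge a ha b hb hab hne
        rcases hor with h1 | h1
        · rw [h1] at haA hadj
          exact Or.inl ⟨haA, hadj, h1, fun h2 => hne (h1.trans h2.symm)⟩
        · rw [h.rep_self b hbR] at h1
          exact Or.inr ⟨h1 ▸ hb, h1⟩
      have hne : rep x ≠ rep y := by
        rcases hc with ⟨h1, h2⟩ | ⟨h1, h2⟩
        · exact fun he => h2 (he.symm.trans h1)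
        · exact fun he => h1 (he.trans h2)
      have hor : rep x = v ∨ rep y = v := hc.imp (fun h => h.1) (fun h => h.2)
      by_cases hx : x ∈ A
      · exact ⟨x, y, rfl, hx, (hA x y hxy).1 hx, hxy, key x y hx ((hA x y hxy).1 hx) hxy hne hor⟩
      · have hy : y ∈ A := by
          by_contra hy
          exact hx ((hA x y hxy).2 hy)
        exact ⟨y, x, Sym2.eq_swap, hy, hx, hxy.symm,
          key y x hy hx hxy.symm hne.symm hor.symm⟩
  refine iSup₂_le fun M hM => ?_
  by_cases hvA : v ∈ A
  · have h1 : ∀ e : M, ∃ a b, e.1 = s(a, b) ∧ G.Adj a b ∧ G.Adj v b ∧ rep a = v ∧ rep b ≠ v :=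
        fun e => by
      obtain ⟨a, b, he, -, -, hab, ⟨-, hvb, hav, hbv⟩ | ⟨hv', -⟩⟩ := cross e.1 (hM.1 e.2)
      · exact ⟨a, b, he, hab, hvb, hav, hbv⟩
      · exact absurd hvA hv'
    choose a b he hab hvb hav hbv using h1
    have hinj : Function.Injective a := fun e f hef => by
      by_contra hne
      exact (hM.2 e.1 e.2 f.1 f.2 (fun h => hne (Subtype.ext h)) (a e) (by rw [he e]; simp) (a f)
        (by rw [he f]; simp)).1 hef
    have : Fintype M := Fintype.ofFinite _
    have hanti : IsTraceAntichain G v (Finset.univ.image a) := by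
      intro x hx y hy hxy
      simp only [Finset.mem_image, Finset.mem_univ, true_and] at hx hy
      obtain ⟨e, rfl⟩ := hx
      obtain ⟨f, rfl⟩ := hy
      have hef : e ≠ f := fun h => hxy (by rw [h])
      refine ⟨b e, hvb e, (hab e).symm, fun hadj => ?_⟩
      -- An edge from `b e` to `a f` would itself cross the cut, contradicting that the matching is
      -- induced.
      have hd := hM.2 e.1 e.2 f.1 f.2 (fun h => hef (Subtype.ext h))
      refine (hd (b e) (by rw [he e]; simp) (a f) (by rw [he f]; simp)).2 ?_
      exact SimpleGraph.between_adj.2 ⟨hadj, Or.inr ⟨hbv e, hav f⟩⟩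
    have hcard := hw hvA _ hanti
    rw [Finset.card_image_of_injective _ hinj, Finset.card_univ] at hcard
    rw [Set.encard, ENat.card_eq_coe_fintype_card]
    exact_mod_cast hcard
  · have : M.Subsingleton := fun e he f hf => by
      by_contra hne
      obtain ⟨a, b, h1, -, -, -, ⟨hv', -⟩ | ⟨-, rfl⟩⟩ := cross e (hM.1 he)
      · exact hvA hv'
      obtain ⟨a', b', h2, -, -, -, ⟨hv', -⟩ | ⟨-, rfl⟩⟩ := cross f (hM.1 hf)
      · exact hvA hv'
      exact (hM.2 e he f hf hne b' (by rw [h1]; simp) b' (by rw [h2]; simp)).1 rfl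
    exact (Set.encard_le_one_iff_subsingleton.2 this).trans (by exact_mod_cast hk)

end Clusters

/-! ### Branch decompositions from parent functions -/

/-- The function `par` maps the nodes of a rooted binary tree with nodes `0, …, m - 1` and leaves
`0, …, n - 1` to their parents; the root is mapped to a number that is not a node. -/
structure IsParentMap (n m : ℕ) (par : ℕ → ℕ) : Prop where
  pos : 0 < n
  le : n ≤ m
  lt_par : ∀ x < m, x < par x
  le_par : ∀ x < m, n ≤ par x
  par_lt : ∀ x, x + 1 < m → par x < m
  two : ∀ c, n ≤ c → c < m →
    ∃ y z, y ≠ z ∧ y < m ∧ z < m ∧ ∀ w < m, par w = c ↔ w = y ∨ w = z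

namespace IsParentMap

variable {n m : ℕ} {par : ℕ → ℕ} (h : IsParentMap n m par)

/-- The tree of a parent function. -/
def graph (h : IsParentMap n m par) : SimpleGraph (Fin m) where
  Adj x y := par x = y ∨ par y = x
  symm := ⟨fun _ _ => Or.symm⟩
  loopless := ⟨fun x hx => by
    have := h.lt_par x x.2
    omega⟩

/-- The node `y` is a descendant of `x`. -/
def Desc (par : ℕ → ℕ) (y x : Fin m) : Prop :=
  Relation.ReflTransGen (fun a b : Fin m => par a = b) y x

include h

lemma desc_le {y x : Fin m} (hyx : Desc par y x) : y ≤ x := by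
  induction hyx with
  | refl => exact le_rfl
  | @tail a b _ hab ih =>
    have := h.lt_par a a.2
    exact ih.trans (by rw [Fin.le_def]; omega)

lemma exists_root_lt : 0 < m := h.pos.trans_le h.le

/-- Edges to parents other than that of `x` remain when the edge from `x` is deleted. -/
lemma deleteEdges_adj {x p y q : Fin m} (hq : par y = q) (hp : par x = p) (hyx : y ≠ x) :
    (h.graph.deleteEdges {s(x, p)}).Adj y q := by
  rw [SimpleGraph.deleteEdges_adj]
  refine ⟨Or.inl hq, fun he => ?_⟩
  rcases Sym2.eq_iff.1 (Set.mem_singleton_iff.1 he) with ⟨h1, _⟩ | ⟨h1, h2⟩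
  · exact hyx h1
  · have := h.lt_par x x.2
    have := h.lt_par y y.2
    subst h1 h2
    omega

lemma reachable_of_desc {x p y : Fin m} (hp : par x = p) (hy : Desc par y x) :
    (h.graph.deleteEdges {s(x, p)}).Reachable x y := by
  induction hy using Relation.ReflTransGen.head_induction_on with
  | refl => exact SimpleGraph.Reachable.refl _
  | @head a c hac hc ih =>
    have h1 := h.desc_le hc
    have h2 := h.lt_par a a.2
    refine ih.trans (h.deleteEdges_adj hac hp ?_).symm.reachable
    rintro rfl
    rw [Fin.le_def] at h1
    omega

/-- Parents have larger numbers, so following them ends at the root `m - 1`. The predicate `q`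
confines this climb to a parent-closed set, which allows `T` to lack an edge. -/
lemma reachable_root (q : Fin m → Prop) (T : SimpleGraph (Fin m))
    (hT : ∀ y z : Fin m, q y → par y = z → T.Adj y z ∧ q z) (y : Fin m) (hy : q y) :
    T.Reachable y ⟨m - 1, by have := h.exists_root_lt; omega⟩ := by
  obtain ⟨d, hd⟩ : ∃ d, d = m - (y : ℕ) := ⟨_, rfl⟩
  induction d using Nat.strong_induction_on generalizing y with
  | _ d ih =>
    by_cases hr : (y : ℕ) + 1 < m
    · have h1 := h.par_lt y hr
      have h2 := h.lt_par y y.2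
      obtain ⟨hadj, hq⟩ := hT y ⟨par y, h1⟩ hy rfl
      exact hadj.reachable.trans (ih (m - par y) (by omega) ⟨par y, h1⟩ hq rfl)
    · have : y = ⟨m - 1, by have := h.exists_root_lt; omega⟩ := by
        ext
        have := y.2
        simp
        omega
      rw [← this]

lemma connected : h.graph.Connected := by
  have := fun y => h.reachable_root (fun _ => True) h.graph
    (fun y z _ hz => ⟨Or.inl hz, trivial⟩) y trivial
  exact (SimpleGraph.connected_iff _).2 ⟨fun x y => (this x).trans (this y).symm,
    ⟨⟨m - 1, by have := h.exists_root_lt; omega⟩⟩⟩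

lemma not_desc_par {x p : Fin m} (hp : par x = p) : ¬ Desc par p x := fun hd => by
  have h1 := h.desc_le hd
  have h2 := h.lt_par x x.2
  rw [Fin.le_def] at h1
  omega

lemma reachable_of_not_desc {x p y : Fin m} (hp : par x = p) (hy : ¬ Desc par y x) :
    (h.graph.deleteEdges {s(x, p)}).Reachable p y := by
  have key := h.reachable_root (fun y => ¬ Desc par y x) (h.graph.deleteEdges {s(x, p)})
    (fun y z hy hz => ⟨h.deleteEdges_adj hz hp (by rintro rfl; exact hy .refl),
      fun hd => hy (.head hz hd)⟩)
  exact (key p (h.not_desc_par hp)).trans (key y hy).symm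

/-- The only edge leaving the set of descendants of `x` is the deleted one: a step down stays below
`x`, and so does a step up from a descendant other than `x`. -/
lemma reachable_iff_desc {x p y : Fin m} (hp : par x = p) :
    (h.graph.deleteEdges {s(x, p)}).Reachable x y ↔ Desc par y x := by
  refine ⟨fun hr => ?_, h.reachable_of_desc hp⟩
  rw [SimpleGraph.reachable_iff_reflTransGen] at hr
  induction hr with
  | refl => exact .refl
  | @tail a b _ hab ih =>
    rw [SimpleGraph.deleteEdges_adj] at hab
    rcases hab.1 with h1 | h1
    · rcases Relation.ReflTransGen.cases_head ih with rfl | ⟨c, hc, hcx⟩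
      · have : p = b := by ext; rw [← hp, h1]
        exact absurd (by rw [this]; exact Set.mem_singleton _) hab.2
      · have : c = b := by ext; rw [← hc, h1]
        rwa [← this]
    · exact .head h1 ih

lemma reachable_iff_not_desc {x p y : Fin m} (hp : par x = p) :
    (h.graph.deleteEdges {s(x, p)}).Reachable p y ↔ ¬ Desc par y x := by
  refine ⟨fun hr hd => ?_, h.reachable_of_not_desc hp⟩
  exact h.not_desc_par hp
    ((h.reachable_iff_desc hp).1 ((h.reachable_of_desc hp hd).trans hr.symm))

lemma isTree : h.graph.IsTree := by
  refine ⟨h.connected, SimpleGraph.isAcyclic_iff_forall_adj_isBridge.2 fun x y hxy => ?_⟩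
  rcases hxy with hxy | hxy
  · rw [SimpleGraph.isBridge_iff, h.reachable_iff_desc hxy]
    exact h.not_desc_par hxy
  · rw [Sym2.eq_swap, SimpleGraph.isBridge_iff, h.reachable_iff_desc hxy]
    exact h.not_desc_par hxy

lemma subcubic (x : Fin m) : deg h.graph x ≤ 3 := by
  by_cases hx : (x : ℕ) < n
  · refine le_trans (Set.encard_le_one_iff.2 fun a b ha hb => ?_) (by norm_num)
    have h1 := h.le_par a a.2
    have h2 := h.le_par b b.2
    ext
    rcases ha with ha | ha <;> rcases hb with hb | hb <;> omega
  · obtain ⟨y, z, hyz, hy, hz, hw⟩ := h.two x (by omega) x.2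
    have hsub : h.graph.neighborSet x ⊆ insert ⟨y, hy⟩ (insert ⟨z, hz⟩ {w | par x = w}) := by
      intro w hxw
      rcases hxw with h1 | h1
      · exact Or.inr (Or.inr h1)
      · rcases (hw w w.2).1 h1 with h2 | h2
        · exact Or.inl (Fin.ext h2)
        · exact Or.inr (Or.inl (Fin.ext h2))
    have hone : ({w : Fin m | par x = w} : Set (Fin m)).encard ≤ 1 :=
      Set.encard_le_one_iff.2 fun a b ha hb => Fin.ext (ha.symm.trans hb)
    calc deg h.graph x ≤ _ := Set.encard_le_encard hsub
      _ ≤ _ := Set.encard_insert_le _ _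
      _ ≤ (1 + 1) + 1 := by
        gcongr
        exact (Set.encard_insert_le _ _).trans (by gcongr)
      _ = 3 := by norm_num

lemma deg_le_one_iff (x : Fin m) : deg h.graph x ≤ 1 ↔ (x : ℕ) < n := by
  constructor
  · intro hd
    by_contra hx
    obtain ⟨y, z, hyz, hy, hz, hw⟩ := h.two x (by omega) x.2
    have h1 := Set.encard_le_one_iff.1 hd ⟨y, hy⟩ ⟨z, hz⟩ (Or.inr ((hw y hy).2 (Or.inl rfl)))
      (Or.inr ((hw z hz).2 (Or.inr rfl)))
    exact hyz (by simpa using h1)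
  · intro hx
    refine Set.encard_le_one_iff.2 fun a b ha hb => ?_
    have h1 := h.le_par a a.2
    have h2 := h.le_par b b.2
    ext
    rcases ha with ha | ha <;> rcases hb with hb | hb <;> omega

omit h in
/-- The branch decomposition of a parent function. -/
def toBranchDecomposition (h : IsParentMap n m par) : BranchDecomposition (Fin n) where
  m := m
  T := h.graph
  isTree := h.isTree
  subcubic := h.subcubic
  δ :=
    { toFun := fun v => ⟨⟨v, v.2.trans_le h.le⟩, (h.deg_le_one_iff _).2 v.2⟩
      invFun := fun x => ⟨x.1, (h.deg_le_one_iff _).1 x.2⟩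
      left_inv := fun _ => rfl
      right_inv := fun _ => rfl }

/-- The conditions on `cl` force it to give the leaves below each node. Every tree edge joins a node
to its parent, so its cut is some `cl x` or the complement, and these have the same value. -/
lemma mimw_le (G : SimpleGraph (Fin n)) (k : ℕ) (cl : ℕ → Set (Fin n))
    (hleaf : ∀ v : Fin n, cl v = {v})
    (hcl : ∀ c, n ≤ c → c < m → ∀ v, v ∈ cl c ↔ ∃ w < m, par w = c ∧ v ∈ cl w)
    (hcut : ∀ x < m, cutMim G (cl x) ≤ k) : h.toBranchDecomposition.mimw G ≤ k := by
  have desc_iff : ∀ (x : Fin m) (v : Fin n),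
      Desc par ⟨v, v.2.trans_le h.le⟩ x ↔ v ∈ cl x := by
    intro x v
    constructor
    · intro hd
      induction hd with
      | refl => simp [hleaf]
      | @tail a b _ hab ih =>
        exact (hcl b (hab ▸ h.le_par a a.2) b.2 v).2 ⟨a, a.2, hab, ih⟩
    · obtain ⟨d, hd⟩ : ∃ d, d = (x : ℕ) := ⟨_, rfl⟩
      induction d using Nat.strong_induction_on generalizing x with
      | _ d ih =>
        intro hv
        by_cases hx : (x : ℕ) < n
        · have := hleaf ⟨x, hx⟩
          simp only at this
          rw [this] at hv
          subst hv
          exact .refl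
        · obtain ⟨w, hw, hwx, hvw⟩ := (hcl x (by omega) x.2 v).1 hv
          have := h.lt_par w hw
          exact .tail (ih w (by omega) ⟨w, hw⟩ rfl hvw) hwx
  refine iSup_le fun (x : Fin m) => iSup_le fun (y : Fin m) => iSup_le fun hxy => ?_
  rcases hxy with hxy | hxy
  · have : h.toBranchDecomposition.side x y = cl x := by
      ext v
      exact (h.reachable_iff_desc hxy).trans (desc_iff x v)
    rw [this]
    exact hcut x x.2
  · have : h.toBranchDecomposition.side x y = (cl y)ᶜ := by
      ext v
      have h1 : v ∈ h.toBranchDecomposition.side x y ↔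
          (h.graph.deleteEdges {s(y, x)}).Reachable x ⟨v, v.2.trans_le h.le⟩ := by
        rw [Sym2.eq_swap]; rfl
      rw [h1, h.reachable_iff_not_desc hxy, desc_iff]
      rfl
    rw [this, cutMim_compl]
    exact hcut y y.2

end IsParentMap

section HostTree

/-! ### Rooted trees -/

section Rooted

variable {W : Type u} {H : SimpleGraph W} {r : W} {p : W → W} {d : W → ℕ}

/-- The functions `p` and `d` map the vertices of a tree with root `r` to their parents and to
their depths. -/
structure IsRooted (H : SimpleGraph W) (r : W) (p : W → W) (d : W → ℕ) : Prop where
  root : d r = 0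
  adj : ∀ y, y ≠ r → H.Adj y (p y)
  lt : ∀ y, y ≠ r → d (p y) < d y
  edge : ∀ y z, H.Adj y z → (y ≠ r ∧ p y = z) ∨ (z ≠ r ∧ p z = y)

/-- The depth is the distance to `r`, and the parent is the neighbour closer to `r`. It is unique,
since two such neighbours would give two shortest paths to `r`. -/
lemma exists_isRooted (hH : H.IsTree) (r : W) : ∃ p d, IsRooted H r p d := by
  classical
  have h1 : ∀ y, y ≠ r → ∃ z, H.Adj y z ∧ H.dist r y = H.dist r z + 1 := by
    intro y hy
    obtain ⟨w, hw⟩ := (hH.connected y r).exists_walk_length_eq_dist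
    cases w with
    | nil => exact absurd rfl hy
    | @cons _ z _ hyz q =>
      refine ⟨z, hyz, ?_⟩
      have h2 := SimpleGraph.dist_le q
      rw [SimpleGraph.Walk.length_cons] at hw
      rw [SimpleGraph.dist_comm] at hw h2
      rcases hH.dist_eq_dist_add_one_of_adj r hyz with h3 | h3
      · exact h3
      · omega
  have h2 : ∀ y z z', H.Adj y z → H.Adj y z' → H.dist r y = H.dist r z + 1 →
      H.dist r y = H.dist r z' + 1 → z = z' := by
    intro y z z' hz hz' hd hd'
    obtain ⟨q, hq⟩ := (hH.connected z r).exists_walk_length_eq_dist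
    obtain ⟨q', hq'⟩ := (hH.connected z' r).exists_walk_length_eq_dist
    rw [SimpleGraph.dist_comm] at hq hq'
    have e1 : (SimpleGraph.Walk.cons hz q).IsPath := by
      apply SimpleGraph.Walk.isPath_of_length_eq_dist
      rw [SimpleGraph.Walk.length_cons, SimpleGraph.dist_comm]
      omega
    have e2 : (SimpleGraph.Walk.cons hz' q').IsPath := by
      apply SimpleGraph.Walk.isPath_of_length_eq_dist
      rw [SimpleGraph.Walk.length_cons, SimpleGraph.dist_comm]
      omega
    have := (hH.existsUnique_path y r).unique e1 e2
    injection this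
  choose! p hp using h1
  refine ⟨p, H.dist r, by simp, fun y hy => (hp y hy).1, fun y hy => ?_, fun y z hyz => ?_⟩
  · have := (hp y hy).2
    omega
  · rcases hH.dist_eq_dist_add_one_of_adj r hyz with h3 | h3
    · have hy : y ≠ r := by rintro rfl; simp at h3
      exact Or.inl ⟨hy, h2 y _ _ (hp y hy).1 hyz (hp y hy).2 h3⟩
    · have hz : z ≠ r := by rintro rfl; simp at h3
      exact Or.inr ⟨hz, h2 z _ _ (hp z hz).1 hyz.symm (hp z hz).2 h3⟩

namespace IsRooted

variable (h : IsRooted H r p d)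
include h

/-- A connected set contains the parents of its vertices, except for its top vertex. -/
lemma parent_mem {S : Set W} (hS : (H.induce S).Preconnected) {τ x : W} (hτ : τ ∈ S)
    (hmin : ∀ y ∈ S, d τ ≤ d y) (hx : x ∈ S) (hxτ : x ≠ τ) : x ≠ r ∧ p x ∈ S := by
  by_contra hcon
  -- If `S` does not contain a parent of `x`, a walk inside `S` can never climb past `x`. All of `S`
  -- then lies below `x`, including `τ`, which contradicts the minimal depth of `τ`.
  have key : ∀ y : S, (H.induce S).Reachable ⟨x, hx⟩ y →
      Relation.ReflTransGen (fun a b => a ≠ r ∧ p a = b) y.1 x := by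
    intro y hy
    rw [SimpleGraph.reachable_iff_reflTransGen] at hy
    induction hy with
    | refl => exact .refl
    | @tail a b _ hab ih =>
      rcases h.edge a.1 b.1 hab with ⟨h1, h2⟩ | ⟨h1, h2⟩
      · rcases Relation.ReflTransGen.cases_head ih with h3 | ⟨c, ⟨_, hc⟩, hcx⟩
        · rw [h3] at h1 h2
          exact absurd ⟨h1, h2 ▸ b.2⟩ hcon
        · rwa [← h2, hc]
      · exact .head ⟨h1, h2⟩ ih
  rcases Relation.ReflTransGen.cases_head (key ⟨τ, hτ⟩ (hS _ _)) with h3 | ⟨c, ⟨hr, hc⟩, hcx⟩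
  · exact hxτ h3.symm
  · have hle : d x ≤ d c := by
      clear hc key hcon hxτ
      induction hcx using Relation.ReflTransGen.head_induction_on with
      | refl => exact le_rfl
      | @head a b hab _ ih =>
        have := h.lt a hab.1
        rw [hab.2] at this
        omega
    have h4 := h.lt τ hr
    have h5 := hmin x hx
    rw [hc] at h4
    omega

/-- In a tree with few branching vertices of bounded degree, sets of pairwise incomparable vertices
are small. -/
lemma card_le_of_incomparable [Finite W] {t Δ : ℕ} (hΔ : ∀ w, deg H w ≤ Δ)
    (ht : {w | 3 ≤ deg H w}.encard ≤ t) (K : Finset W) (hrK : r ∉ K)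
    (hK : ∀ x ∈ K, ∀ y ∈ K, x ≠ y → ¬ Relation.ReflTransGen (fun a b => a ≠ r ∧ p a = b) x y) :
    K.card ≤ t * Δ + 2 := by
  classical
  have := Fintype.ofFinite W
  -- Each vertex climbs through vertices that are neither branching nor the root, until its parent
  -- is branching or the root; `f` gives the end of the climb. These end points are the objects
  -- counted.
  let st : W → W → Prop := fun a b => a ≠ r ∧ p a = b ∧ b ≠ r ∧ ¬ 3 ≤ deg H b
  have hst : ∀ a b, Relation.ReflTransGen st a b →
      Relation.ReflTransGen (fun a b => a ≠ r ∧ p a = b) a b :=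
    Relation.ReflTransGen.mono fun _ _ h => ⟨h.1, h.2.1⟩
  have key : ∀ n a, d a = n → a ≠ r → ∃ x, x ≠ r ∧ (p x = r ∨ 3 ≤ deg H (p x)) ∧
      Relation.ReflTransGen st a x := by
    intro n
    induction n using Nat.strong_induction_on with
    | _ n ih =>
      intro a ha har
      by_cases hp : p a = r ∨ 3 ≤ deg H (p a)
      · exact ⟨a, har, hp, .refl⟩
      · rw [not_or] at hp
        obtain ⟨x, h1, h2, h3⟩ := ih (d (p a)) (ha ▸ h.lt a har) (p a) rfl hp.1
        exact ⟨x, h1, h2, .head ⟨har, rfl, hp.1, hp.2⟩ h3⟩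
  choose! f hf1 hf2 hf3 using fun a => key (d a) a rfl
  -- A non-root vertex of degree at most `2` has at most one child. Vertices whose climbs end at the
  -- same place therefore lie on one descending path and are comparable, so `f` is injective on `K`.
  have huniq : Relator.RightUnique (Function.swap st) := by
    rintro c a b ⟨ha, hac, hcr, hc⟩ ⟨hb, hbc, -, -⟩
    by_contra hab
    refine hc ?_
    have hpc := h.lt c hcr
    have hca := h.lt a ha
    have hcb := h.lt b hb
    rw [hac] at hca
    rw [hbc] at hcb
    have : ({a, b, p c} : Set W) ⊆ H.neighborSet c := by
      rintro w (rfl | rfl | rfl)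
      · exact hac ▸ (h.adj w ha).symm
      · exact hbc ▸ (h.adj w hb).symm
      · exact h.adj c hcr
    refine le_trans ?_ (Set.encard_le_encard this)
    rw [Set.encard_eq_three.2 ⟨a, b, p c, hab, by rintro rfl; omega, by rintro rfl; omega, rfl⟩]
  have hinj : Set.InjOn f K := by
    intro a ha b hb hab
    by_contra hne
    have har : a ≠ r := by rintro rfl; exact hrK ha
    have hbr : b ≠ r := by rintro rfl; exact hrK hb
    have h1 := hf3 a har
    have h2 := hf3 b hbr
    rw [← hab] at h2
    rcases Relation.ReflTransGen.total_of_right_unique huniq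
      (Relation.reflTransGen_swap.2 h1) (Relation.reflTransGen_swap.2 h2) with h3 | h3
    · exact hK b hb a ha (Ne.symm hne) (hst _ _ (Relation.reflTransGen_swap.1 h3))
    · exact hK a ha b hb hne (hst _ _ (Relation.reflTransGen_swap.1 h3))
  rw [← Finset.card_image_of_injOn hinj]
  let N : W → Finset W := fun w => Finset.univ.filter fun z => H.Adj w z
  have hN : ∀ w, ((N w).card : ℕ∞) = deg H w := fun w => by
    rw [deg, ← Set.encard_coe_eq_coe_finsetCard]
    congr 1
    ext z
    simp [N]
  let Br : Finset W := Finset.univ.filter fun w => 3 ≤ deg H w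
  have hBr : Br.card ≤ t := by
    have : ((Br.card : ℕ) : ℕ∞) ≤ t := by
      rw [← Set.encard_coe_eq_coe_finsetCard]
      simpa [Br] using ht
    exact_mod_cast this
  -- The neighbours of the root are counted separately only if it is not branching, which gives the
  -- summand `2`.
  have hN2 : (if 3 ≤ deg H r then ∅ else N r).card ≤ 2 := by
    split_ifs with h3
    · simp
    · rw [← hN r] at h3
      have : ¬ 3 ≤ (N r).card := by exact_mod_cast h3
      omega
  calc (K.image f).card ≤ ((Br.biUnion N) ∪ (if 3 ≤ deg H r then ∅ else N r)).card := by
        refine Finset.card_le_card fun x hx => ?_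
        obtain ⟨a, ha, rfl⟩ := Finset.mem_image.1 hx
        have har : a ≠ r := by rintro rfl; exact hrK ha
        have hadj : f a ∈ N (p (f a)) := by simpa [N] using (h.adj _ (hf1 a har)).symm
        by_cases h3 : 3 ≤ deg H (p (f a))
        · exact Finset.mem_union_left _ (Finset.mem_biUnion.2 ⟨_, by simpa [Br] using h3, hadj⟩)
        · have hpr := (hf2 a har).resolve_right h3
          rw [hpr] at h3 hadj
          exact Finset.mem_union_right _ (by rwa [if_neg h3])
    _ ≤ (Br.biUnion N).card + _ := Finset.card_union_le _ _
    _ ≤ t * Δ + 2 := by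
        refine Nat.add_le_add ((Finset.card_biUnion_le_card_mul _ _ Δ fun w _ => ?_).trans
          (Nat.mul_le_mul_right _ hBr)) hN2
        have := hΔ w
        rw [← hN w] at this
        exact_mod_cast this

end IsRooted

end Rooted

/-! ### Consequences of tree convexity -/

/-- Here `t ≤ t ^ 2`, and `2 * Δ - 1` alone covers the summand `2`. -/
lemma le_mimBound {t Δ : ℕ} (hΔ : 3 ≤ Δ) : t * Δ + 2 ≤ mimBound t Δ := by
  unfold mimBound
  have h1 : t * Δ ≤ t ^ 2 * Δ := Nat.mul_le_mul_right _ (Nat.le_self_pow (by norm_num) t)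
  have h2 := le_max_right (2 * ⌊((Δ : ℚ) / 2) ^ 2⌋₊) (2 * Δ - 1)
  omega

variable {V : Type u} [Fintype V] [DecidableEq V] {G : SimpleGraph V}

/-- The vertex set of a host tree is a side of the graph, it is dismantlable, and all trace widths
are small. -/
theorem IsTreeConvex.exists_side {t Δ : ℕ} (hΔ : 3 ≤ Δ) (hG : IsTreeConvex t Δ G) :
    ∃ A : Finset V, A.Nonempty ∧ IsSide G A Finset.univ ∧ Dismantlable G A ∧
      ∀ r ∈ A, TraceWidthLE G (mimBound t Δ) r := by
  classical
  obtain ⟨A, B, -, hbip, H, hH, hconn⟩ := hG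
  have hB : ∀ a ∈ A, ∀ b, G.Adj a b → b ∈ B := fun a ha b hab => by
    rcases hbip.mem_of_adj hab with h | h
    · exact h.2
    · exact absurd h.1 (Set.disjoint_left.1 hbip.disjoint ha)
  obtain ⟨r₀⟩ := hH.isTree.connected.nonempty
  refine ⟨A.toFinset, ⟨r₀, by simp⟩, ⟨fun _ _ _ _ => Finset.mem_univ _, fun x _ y hxy => ?_⟩,
    ?_, fun r hr K hK => ?_⟩
  · simp only [Set.mem_toFinset]
    have hdisj := Set.disjoint_left.1 hbip.disjoint
    rcases hbip.mem_of_adj hxy with h | h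
    · exact ⟨fun _ hy => hdisj hy h.2, fun _ => h.1⟩
    · exact ⟨fun hx => absurd h.1 (hdisj hx), fun hy => absurd h.2 hy⟩
  · obtain ⟨p, d, h⟩ := exists_isRooted hH.isTree r₀
    suffices key : ∀ n, ∀ X : Finset A, X.card = n → (∀ x ∈ X, x ≠ r₀ → p x ∈ X) →
        Dismantlable G (X.image Subtype.val) by
      have := key _ Finset.univ rfl (fun _ _ _ => Finset.mem_univ _)
      convert this
      ext x
      simp
    intro n
    induction n with
    | zero =>
      intro X hX _
      exact .base (Finset.card_image_le.trans (by omega))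
    | succ n ih =>
      intro X hX hp
      by_cases hn : X.card ≤ 1
      · exact .base (Finset.card_image_le.trans hn)
      -- The deepest vertex is a leaf of the remaining subtree, and its parent dominates it.
      obtain ⟨a, haX, hmax⟩ := X.exists_max_image d (Finset.card_pos.1 (by omega))
      have har : a ≠ r₀ := by
        rintro rfl
        obtain ⟨x, hx, hxa⟩ := Finset.exists_mem_ne (not_le.1 hn) a
        have h1 := hmax x hx
        have h2 := h.lt x hxa
        have h3 := h.root
        omega
      have hlt := h.lt a har
      have hpa : p a ≠ a := fun he => by rw [he] at hlt; omega
      refine .step (a := a.1) (a' := (p a).1) (Finset.mem_image_of_mem _ haX)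
        (Finset.mem_image_of_mem _ (hp a haX har)) (fun he => hpa (Subtype.ext he.symm)) ?_ ?_
      · rintro b hb ⟨x, hx, hxa, hbx⟩
        obtain ⟨x, hxX, rfl⟩ := Finset.mem_image.1 hx
        have hbB := hB a a.2 b hb.symm
        obtain ⟨τ, hτ, hmin⟩ := Finset.exists_min_image (Finset.univ.filter fun a : A => G.Adj b a)
          d ⟨a, by simpa using hb⟩
        simp only [Finset.mem_filter, Finset.mem_univ, true_and] at hτ hmin
        have hS := fun {x : A} => h.parent_mem (S := {a : A | G.Adj b a}) (hconn b hbB) (x := x)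
          hτ hmin
        -- The deepest vertex cannot be the top of the neighbourhood of `b`, because `b` sees the
        -- further vertex `x` of `X`, which would have to be deeper still.
        by_cases haτ : a = τ
        · subst haτ
          obtain ⟨h1, h2⟩ := hS (x := x) hbx (fun he => hxa (by rw [he]))
          have h3 := h.lt x h1
          have h4 := hmin _ h2
          have h5 := hmax x hxX
          omega
        · exact (hS hb haτ).2
      · rw [← Finset.image_erase Subtype.val_injective]
        refine ih _ (by rw [Finset.card_erase_of_mem haX]; omega) fun x hx hxr => ?_
        rw [Finset.mem_erase] at hx ⊢
        refine ⟨fun he => ?_, hp x hx.2 hxr⟩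
        have h1 := h.lt x hxr
        have h2 := hmax x hx.2
        rw [he] at h1
        omega
  · refine le_trans ?_ (le_mimBound hΔ)
    by_cases hK1 : K.card ≤ 1
    · omega
    rw [Set.mem_toFinset] at hr
    obtain ⟨p, d, h⟩ := exists_isRooted hH.isTree ⟨r, hr⟩
    -- With the tree rooted at `r`, neighbourhoods containing `r` are closed under parents, so
    -- traces grow towards the root.
    have hanc : ∀ x y : A, Relation.ReflTransGen (fun a b => a ≠ ⟨r, hr⟩ ∧ p a = b) x y →
        ∀ b, G.Adj r b → G.Adj b x → G.Adj b y := by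
      intro x y hxy b hrb hbx
      induction hxy with
      | refl => exact hbx
      | @tail u v _ huv ih =>
        rw [← huv.2]
        exact (h.parent_mem (S := {a : A | G.Adj b a}) (hconn b (hB r hr b hrb)) (τ := ⟨r, hr⟩)
          hrb.symm (fun y _ => by rw [h.root]; exact Nat.zero_le _) ih huv.1).2
    have hKA : ∀ x ∈ K, x ∈ A := fun x hx => by
      obtain ⟨y, hy, hyx⟩ := Finset.exists_mem_ne (not_le.1 hK1) x
      obtain ⟨b, hrb, hbx, -⟩ := hK x hx y hy hyx.symm
      rcases hbip.mem_of_adj hbx with h | h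
      · exact absurd (hB r hr b hrb) (Set.disjoint_left.1 hbip.disjoint h.1)
      · exact h.2
    -- The trace of `r` is its whole neighbourhood and hence comparable with every other trace.
    have hrK : r ∉ K := fun hrK => by
      obtain ⟨y, hy, hyr⟩ := Finset.exists_mem_ne (not_le.1 hK1) r
      obtain ⟨b, hrb, -, hbr⟩ := hK y hy r hrK hyr
      exact hbr hrb.symm
    have hcard : (K.subtype (· ∈ A)).card = K.card := by
      rw [Finset.card_subtype, Finset.filter_true_of_mem hKA]
    rw [← hcard]
    refine h.card_le_of_incomparable hH.deg_le hH.branching_le _ (by simpa using hrK)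
      fun x hx y hy hxy hd => ?_
    rw [Finset.mem_subtype] at hx hy
    obtain ⟨b, hrb, hbx, hby⟩ := hK x hx y hy (fun he => hxy (Subtype.ext he))
    exact hby (hanc x y hd b hrb hbx)

end HostTree

/-! ### The forest built by the merging process -/

section Forest

variable {n k c : ℕ} {G : SimpleGraph (Fin n)} {A R : Finset (Fin n)} {par cur : ℕ → ℕ}

/-- The numbers less than `c` are the nodes of a forest with parent function `par`, whose roots are
the numbers `cur v` for the remaining vertices `v`. The set `cl y` is the set of leaves below the
node `y`. -/
structure ForestData (G : SimpleGraph (Fin n)) (k : ℕ) (A R : Finset (Fin n)) (par cur : ℕ → ℕ)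
    (c : ℕ) (rep : Fin n → Fin n) (cl : ℕ → Set (Fin n)) : Prop where
  cluster : ClusterInv G A R rep
  count : c + R.card = 2 * n
  cur_lt : ∀ v ∈ R, cur v < c
  cur_inj : ∀ v ∈ R, ∀ w ∈ R, cur v = cur w → v = w
  cl_cur : ∀ v ∈ R, cl (cur v) = {x | rep x = v}
  cl_leaf : ∀ v : Fin n, cl v = {v}
  cut : ∀ y < c, cutMim G (cl y) ≤ k
  par_root : ∀ v ∈ R, par (cur v) = 2 * n
  par_free : ∀ y, c ≤ y → y < 2 * n → par y = 2 * n
  par_node : ∀ y < c, (∀ v ∈ R, cur v ≠ y) → y < par y ∧ n ≤ par y ∧ par y < c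
  two : ∀ d, n ≤ d → d < c → ∃ y z, y ≠ z ∧ y < c ∧ z < c ∧
    (∀ w < 2 * n, par w = d ↔ w = y ∨ w = z) ∧ cl d = cl y ∪ cl z

/-- The merging process has built a forest. -/
def ForestInv (G : SimpleGraph (Fin n)) (k : ℕ) (A R : Finset (Fin n)) (par cur : ℕ → ℕ)
    (c : ℕ) : Prop :=
  ∃ rep cl, ForestData G k A R par cur c rep cl

lemma forestInv_init (hk : 1 ≤ k) (hA : ∀ x y, G.Adj x y → (x ∈ A ↔ y ∉ A))
    (hpar : ∀ y < 2 * n, par y = 2 * n) (hcur : ∀ v < n, cur v = v) :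
    ForestInv G k A Finset.univ par cur n := by
  -- A singleton is a cluster for either side of the bipartition. Choosing the side that avoids `v`
  -- removes the need for a bound on traces.
  have hc : ∀ v : Fin n, cutMim G {v} ≤ k := fun v => by
    by_cases hv : v ∈ A
    · have := (clusterInv_id (G := G) Aᶜ).cutMim_le (fun x y hxy => by
        have := hA x y hxy
        simp only [Finset.mem_compl]
        tauto) hk (Finset.mem_univ v) (by simp [hv])
      simpa using this
    · have := (clusterInv_id (G := G) A).cutMim_le hA hk (Finset.mem_univ v) (by simp [hv])
      simpa using this
  refine ⟨id, fun y => {x | (x : ℕ) = y}, clusterInv_id A, by simp [two_mul], fun v _ => ?_,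
    fun v _ w _ h => ?_, fun v _ => ?_, fun v => ?_, fun y hy => ?_, fun v _ => ?_,
    fun y _ hy => hpar y hy, fun y hy h => ?_, fun d hd hd' => by omega⟩
  · rw [hcur v v.2]; exact v.2
  · rw [hcur v v.2, hcur w w.2] at h
    exact Fin.ext h
  · rw [hcur v v.2]
    ext x
    simp [Fin.ext_iff]
  · ext x
    simp [Fin.ext_iff]
  · convert hc ⟨y, hy⟩ using 2
    ext x
    simp [Fin.ext_iff]
  · rw [hcur v v.2]
    exact hpar v (by omega)
  · exact absurd (hcur y hy) (h ⟨y, hy⟩ (Finset.mem_univ _))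

/-- The new node `c` becomes the parent of the roots of `u` and `v`, and its leaves form the
enlarged cluster of `v`. The only new cut is thus the cut of a cluster. -/
lemma ForestInv.merge (h : ForestInv G k A R par cur c) (hk : 1 ≤ k)
    (hA : ∀ x y, G.Adj x y → (x ∈ A ↔ y ∉ A)) (hw : ∀ v ∈ A, TraceWidthLE G k v) {u v : Fin n}
    (huv : CanMerge G A R u v) :
    ForestInv G k A (R.erase u) (Function.update (Function.update par (cur u) c) (cur v) c)
      (Function.update cur v c) (c + 1) := by
  obtain ⟨rep, cl, h⟩ := h
  have hm := h.cluster.merge huv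
  have hcard := Finset.card_erase_of_mem huv.left
  have hpos : 1 < R.card := Finset.one_lt_card.2 ⟨u, huv.left, v, huv.right, huv.ne⟩
  have hcount := h.count
  have hRn : R.card ≤ n := by simpa using Finset.card_le_univ R
  have hcu := h.cur_lt u huv.left
  have hcv := h.cur_lt v huv.right
  have hne : cur u ≠ cur v := fun he => huv.ne (h.cur_inj _ huv.left _ huv.right he)
  have hcur : ∀ w : Fin n, w ∈ R.erase u → w ≠ v →
      w ∈ R ∧ Function.update cur v c w = cur w ∧ cur w ≠ cur u ∧ cur w ≠ cur v := by
    intro w hw hwv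
    rw [Finset.mem_erase] at hw
    refine ⟨hw.2, ?_, fun he => hw.1 (h.cur_inj _ hw.2 _ huv.left he),
      fun he => hwv (h.cur_inj _ hw.2 _ huv.right he)⟩
    rw [Function.update_of_ne]
    exact fun he => hwv (Fin.ext he)
  have hcl : ∀ y, y ≠ c → Function.update cl c (cl (cur u) ∪ cl (cur v)) y = cl y :=
    fun y hy => Function.update_of_ne hy _ _
  have hset : cl (cur u) ∪ cl (cur v) = {x | (if rep x = u then v else rep x) = v} := by
    rw [h.cl_cur u huv.left, h.cl_cur v huv.right]
    ext x
    by_cases hx : rep x = u <;> simp [hx]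
  have hpar : ∀ y, y ≠ cur u → y ≠ cur v →
      Function.update (Function.update par (cur u) c) (cur v) c y = par y := fun y h1 h2 => by
    rw [Function.update_of_ne h2, Function.update_of_ne h1]
  have hparu : Function.update (Function.update par (cur u) c) (cur v) c (cur u) = c := by
    rw [Function.update_of_ne hne, Function.update_self]
  have hparv : Function.update (Function.update par (cur u) c) (cur v) c (cur v) = c :=
    Function.update_self ..
  -- The number `c` is not yet a parent: existing parents are below `c`, and roots and unused
  -- numbers have the dummy parent `2 * n`.
  have hpar2 : ∀ y < 2 * n, par y ≠ c := by
    intro y hy he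
    by_cases hyc : c ≤ y
    · have := h.par_free y hyc hy
      omega
    · by_cases hroot : ∀ w ∈ R, cur w ≠ y
      · have := h.par_node y (by omega) hroot
        omega
      · push Not at hroot
        obtain ⟨w, hw, rfl⟩ := hroot
        have := h.par_root w hw
        omega
  refine ⟨_, Function.update cl c (cl (cur u) ∪ cl (cur v)), hm, by omega, fun w hw => ?_,
    fun w hw w' hw' he => ?_, fun w hw => ?_, fun w => ?_, fun y hy => ?_, fun w hw => ?_,
    fun y hy hy' => ?_, fun y hy hroot => ?_, fun d hd hd' => ?_⟩
  · by_cases hwv : w = v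
    · subst hwv; simp
    · obtain ⟨h1, h2, -, -⟩ := hcur w hw hwv
      have := h.cur_lt w h1
      omega
  · by_cases hwv : w = v <;> by_cases hwv' : w' = v
    · rw [hwv, hwv']
    · obtain ⟨h1, h2, -, -⟩ := hcur w' hw' hwv'
      have := h.cur_lt w' h1
      rw [hwv, Function.update_self] at he
      omega
    · obtain ⟨h1, h2, -, -⟩ := hcur w hw hwv
      have := h.cur_lt w h1
      rw [hwv', Function.update_self] at he
      omega
    · obtain ⟨h1, h2, -, -⟩ := hcur w hw hwv
      obtain ⟨h1', h2', -, -⟩ := hcur w' hw' hwv'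
      exact h.cur_inj _ h1 _ h1' (by omega)
  · by_cases hwv : w = v
    · subst hwv
      rw [Function.update_self, Function.update_self, hset]
    · obtain ⟨h1, h2, -, -⟩ := hcur w hw hwv
      have := h.cur_lt w h1
      rw [h2, hcl _ (by omega), h.cl_cur w h1]
      ext x
      have hwu : w ≠ u := (Finset.mem_erase.1 hw).1
      by_cases hx : rep x = u
      · simp [hx, Ne.symm hwu, Ne.symm hwv]
      · simp [hx]
  · rw [hcl _ (by omega)]
    exact h.cl_leaf w
  · by_cases hyc : y = c
    · subst hyc
      rw [Function.update_self, hset]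
      exact hm.cutMim_le hA hk (by simp [huv.right, Ne.symm huv.ne]) (hw v)
    · rw [hcl _ hyc]
      exact h.cut y (by omega)
  · by_cases hwv : w = v
    · subst hwv
      rw [Function.update_self, hpar c (by omega) (by omega)]
      exact h.par_free c le_rfl (by omega)
    · obtain ⟨h1, h2, h3, h4⟩ := hcur w hw hwv
      rw [h2, hpar _ h3 h4, h.par_root w h1]
  · rw [hpar y (by omega) (by omega)]
    exact h.par_free y (by omega) hy'
  · have hyc : y ≠ c := by
      rintro rfl
      exact hroot v (by simp [huv.right, Ne.symm huv.ne]) (Function.update_self ..)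
    by_cases hyu : y = cur u
    · subst hyu
      rw [hparu]
      omega
    by_cases hyv : y = cur v
    · subst hyv
      rw [hparv]
      omega
    rw [hpar y hyu hyv]
    have := h.par_node y (by omega) fun w hw he => by
      have hwu : w ≠ u := by rintro rfl; exact hyu he.symm
      have hwv : w ≠ v := by rintro rfl; exact hyv he.symm
      have hwe : w ∈ R.erase u := Finset.mem_erase.2 ⟨hwu, hw⟩
      exact hroot w hwe ((hcur w hwe hwv).2.1.trans he)
    omega
  · by_cases hdc : d = c
    · subst hdc
      refine ⟨cur u, cur v, hne, by omega, by omega, fun w hw => ?_, ?_⟩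
      · constructor
        · intro hwd
          by_contra hcon
          rw [not_or] at hcon
          rw [hpar w hcon.1 hcon.2] at hwd
          exact hpar2 w hw hwd
        · rintro (rfl | rfl)
          · exact hparu
          · exact hparv
      · rw [Function.update_self, hcl _ (by omega), hcl _ (by omega)]
    · obtain ⟨y, z, hyz, hy, hz, hw2, hcl2⟩ := h.two d hd (by omega)
      refine ⟨y, z, hyz, by omega, by omega, fun w hw => ?_, ?_⟩
      · rw [← hw2 w hw]
        have hru := h.par_root u huv.left
        have hrv := h.par_root v huv.right
        by_cases hwu : w = cur u
        · subst hwu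
          rw [hparu, hru]
          omega
        by_cases hwv : w = cur v
        · subst hwv
          rw [hparv, hrv]
          omega
        rw [hpar w hwu hwv]
      · rw [hcl _ hdc, hcl _ (by omega), hcl _ (by omega), hcl2]

/-- A forest with one root is the tree of a branch decomposition. -/
lemma ForestInv.exists_branchDecomposition (h : ForestInv G k A R par cur c) (hR : R.card = 1) :
    ∃ hp : IsParentMap n (2 * n - 1) par, hp.toBranchDecomposition.mimw G ≤ k := by
  obtain ⟨rep, cl, h⟩ := h
  have hcount := h.count
  obtain ⟨v, rfl⟩ := Finset.card_eq_one.1 hR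
  have hn : 0 < n := v.pos
  obtain rfl : c = 2 * n - 1 := by simp at hcount; omega
  have hnode : ∀ y < 2 * n - 1, cur v ≠ y → y < par y ∧ n ≤ par y ∧ par y < 2 * n - 1 :=
    fun y hy hv => h.par_node y hy (by simpa using hv)
  have hroot := h.par_root v (by simp)
  have hlt := h.cur_lt v (by simp)
  -- Every node other than the root has a larger parent that is a node, so the last node must be the
  -- root.
  have hlast : cur v = 2 * n - 2 := by
    by_contra hne
    have := hnode (2 * n - 2) (by omega) hne
    omega
  have hp : IsParentMap n (2 * n - 1) par := by
    refine ⟨hn, by omega, fun x hx => ?_, fun x hx => ?_, fun x hx => ?_, fun d hd hd' => ?_⟩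
    · by_cases hv : cur v = x
      · rw [← hv, hroot]; omega
      · exact (hnode x hx hv).1
    · by_cases hv : cur v = x
      · rw [← hv, hroot]; omega
      · exact (hnode x hx hv).2.1
    · exact (hnode x (by omega) (by omega)).2.2
    · obtain ⟨y, z, hyz, hy, hz, hw, -⟩ := h.two d hd hd'
      exact ⟨y, z, hyz, hy, hz, fun w hw' => hw w (by omega)⟩
  refine ⟨hp, hp.mimw_le G k cl h.cl_leaf (fun d hd hd' x => ?_) h.cut⟩
  obtain ⟨y, z, hyz, hy, hz, hw, hcl⟩ := h.two d hd hd'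
  rw [hcl]
  constructor
  · rintro (hx | hx)
    · exact ⟨y, hy, (hw y (by omega)).2 (Or.inl rfl), hx⟩
    · exact ⟨z, hz, (hw z (by omega)).2 (Or.inr rfl), hx⟩
  · rintro ⟨w, hw', hwd, hx⟩
    rcases (hw w (by omega)).1 hwd with rfl | rfl
    · exact Or.inl hx
    · exact Or.inr hx

end Forest

/-! ### Logical expressions -/

namespace LExpr

/-- An expression is true if its value is not zero. -/
def IsTrue (n : ℕ) (α : Arrays) (ρ : ℕ → ℕ) (e : LExpr) : Prop := e.eval n α ρ ≠ 0

/-- Negation. -/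
def neg (e : LExpr) : LExpr := .sub (.const 1) e

/-- Disjunction. -/
def or (e f : LExpr) : LExpr := .add e f

/-- Conjunction. -/
def and (e f : LExpr) : LExpr := neg (.add (neg e) (neg f))

/-- Implication. -/
def imp (e f : LExpr) : LExpr := or (neg e) f

/-- Existential quantification. -/
def ex (x : ℕ) (e : LExpr) : LExpr := .sum x e

/-- Universal quantification. -/
def all (x : ℕ) (e : LExpr) : LExpr := neg (.sum x (neg e))

/-- Equality of values. -/
def eq (e f : LExpr) : LExpr := neg (.add (.sub e f) (.sub f e))

/-- The conjunction of `f 0, …, f (k - 1)`. -/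
def conj (f : ℕ → LExpr) : ℕ → LExpr
  | 0 => .const 1
  | k + 1 => and (conj f k) (f k)

/-- Existential quantification over the variables `b, …, b + k - 1`. -/
def exs (e : LExpr) : ℕ → ℕ → LExpr
  | _, 0 => e
  | b, k + 1 => ex b (exs e (b + 1) k)

section

variable {n : ℕ} {α : Arrays} {ρ : ℕ → ℕ} {e f : LExpr}

lemma isTrue_neg : (neg e).IsTrue n α ρ ↔ ¬ e.IsTrue n α ρ := by
  simp only [IsTrue, neg, eval]; omega

lemma isTrue_or : (or e f).IsTrue n α ρ ↔ e.IsTrue n α ρ ∨ f.IsTrue n α ρ := by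
  simp only [IsTrue, or, eval]; omega

lemma isTrue_and : (and e f).IsTrue n α ρ ↔ e.IsTrue n α ρ ∧ f.IsTrue n α ρ := by
  simp only [IsTrue, and, neg, eval]; omega

lemma isTrue_imp : (imp e f).IsTrue n α ρ ↔ (e.IsTrue n α ρ → f.IsTrue n α ρ) := by
  rw [imp, isTrue_or, isTrue_neg]; tauto

lemma isTrue_ex {x : ℕ} :
    (ex x e).IsTrue n α ρ ↔ ∃ i : Fin n, e.IsTrue n α (Function.update ρ x i) := by
  simp [IsTrue, ex, eval, Fin.exists_iff]

lemma isTrue_all {x : ℕ} :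
    (all x e).IsTrue n α ρ ↔ ∀ i : Fin n, e.IsTrue n α (Function.update ρ x i) := by
  have := isTrue_neg (n := n) (α := α) (ρ := ρ) (e := ex x (neg e))
  rw [isTrue_ex] at this
  rw [show all x e = neg (ex x (neg e)) from rfl, this]
  simp [isTrue_neg]

lemma isTrue_eq : (eq e f).IsTrue n α ρ ↔ e.eval n α ρ = f.eval n α ρ := by
  simp only [IsTrue, eq, neg, eval]; omega

lemma isTrue_conj {g : ℕ → LExpr} {k : ℕ} :
    (conj g k).IsTrue n α ρ ↔ ∀ i < k, (g i).IsTrue n α ρ := by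
  induction k with
  | zero => simp [conj, IsTrue, eval]
  | succ k ih =>
    rw [conj, isTrue_and, ih]
    refine ⟨fun h i hi => ?_, fun h => ⟨fun i hi => h i (by omega), h k (by omega)⟩⟩
    rcases Nat.lt_succ_iff_lt_or_eq.1 hi with hi | rfl
    · exact h.1 i hi
    · exact h.2

lemma isTrue_exs {b k : ℕ} : (exs e b k).IsTrue n α ρ ↔ ∃ g : ℕ → ℕ, (∀ i < k, g i < n) ∧
    e.IsTrue n α (fun x => if b ≤ x ∧ x < b + k then g (x - b) else ρ x) := by
  induction k generalizing b ρ with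
  | zero =>
    have : ∀ g : ℕ → ℕ, (fun x => if b ≤ x ∧ x < b + 0 then g (x - b) else ρ x) = ρ := fun g => by
      ext x
      rw [if_neg (by omega)]
    simp only [exs, this]
    simp
  | succ k ih =>
    rw [exs, isTrue_ex]
    simp only [ih]
    constructor
    · rintro ⟨i, g, hg, hi⟩
      refine ⟨fun j => if j = 0 then i else g (j - 1), fun j hj => ?_, ?_⟩
      · dsimp only
        split_ifs
        · exact i.2
        · exact hg _ (by omega)
      · convert hi using 1
        ext x
        by_cases h1 : x = b
        · subst h1
          simp
        · by_cases h2 : b ≤ x ∧ x < b + (k + 1)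
          · rw [if_pos h2, if_pos (by omega)]
            dsimp only
            rw [if_neg (by omega), show x - b - 1 = x - (b + 1) by omega]
          · rw [if_neg h2, if_neg (by omega), Function.update_of_ne h1]
    · rintro ⟨g, hg, h⟩
      refine ⟨⟨g 0, hg 0 (by omega)⟩, fun j => g (j + 1), fun j hj => hg _ (by omega), ?_⟩
      convert h using 1
      ext x
      by_cases h1 : x = b
      · subst h1
        simp
      · by_cases h2 : b ≤ x ∧ x < b + (k + 1)
        · rw [if_pos h2, if_pos (by omega)]
          dsimp only
          rw [show x - (b + 1) + 1 = x - b by omega]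
        · rw [if_neg h2, if_neg (by omega), Function.update_of_ne h1]

end

/-- The entry of the array `a` at the value of the variable `x`. -/
def mem (a x : ℕ) : LExpr := .read a (.var x)

/-- The entry in row `x` and column `y` of the matrix in array `0`. -/
def adj (x y : ℕ) : LExpr := .read 0 (.add (.sum (x + 1) (.var x)) (.var y))

lemma isTrue_mem {n : ℕ} {α : Arrays} {ρ : ℕ → ℕ} {a x : ℕ} :
    (mem a x).IsTrue n α ρ ↔ α a (ρ x) ≠ 0 := Iff.rfl

/-- There is no multiplication in the language: the row offset arises by summing the variable `x`
over `n` rounds, with `x + 1` as a dummy index. -/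
lemma isTrue_adj {n : ℕ} {α : Arrays} {ρ : ℕ → ℕ} {x y : ℕ} :
    (adj x y).IsTrue n α ρ ↔ α 0 (n * ρ x + ρ y) ≠ 0 := by
  simp [IsTrue, adj, eval]

end LExpr

/-- Array `0` holds the adjacency matrix of `G`. -/
def HasAdj {n : ℕ} (G : SimpleGraph (Fin n)) (α : Arrays) : Prop :=
  ∀ i j : Fin n, α 0 (n * i + j) ≠ 0 ↔ G.Adj i j

/-- The vertices with nonzero entry in the array `a`. -/
def supp (n : ℕ) (α : Arrays) (a : ℕ) : Finset (Fin n) := Finset.univ.filter fun v => α a v ≠ 0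

@[simp] lemma mem_supp {n : ℕ} {α : Arrays} {a : ℕ} {v : Fin n} : v ∈ supp n α a ↔ α a v ≠ 0 := by
  simp [supp]

/-! ### Loops -/

lemma Cmd.den_ite_of_isTrue {n : ℕ} {α : Arrays} {ρ : ℕ → ℕ} {e : LExpr} {p q : Cmd}
    (h : e.IsTrue n α ρ) : (Cmd.ite e p q).den n ρ α = p.den n ρ α := if_pos h

lemma Cmd.den_ite_of_not {n : ℕ} {α : Arrays} {ρ : ℕ → ℕ} {e : LExpr} {p q : Cmd}
    (h : ¬ e.IsTrue n α ρ) : (Cmd.ite e p q).den n ρ α = q.den n ρ α := if_neg h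

/-- The effect of a loop that writes consecutive entries of one array. -/
lemma den_loop_write {n : ℕ} {ρ : ℕ → ℕ} {α : Arrays} {a x off : ℕ} {ie e : LExpr} {val : ℕ → ℕ}
    (hi : ∀ β i, ie.eval n β (Function.update ρ x i) = off + i)
    (he : ∀ β : Arrays, ∀ i < n, (∀ b, b ≠ a → β b = α b) → β a (off + i) = α a (off + i) →
      e.eval n β (Function.update ρ x i) = val i) :
    (∀ b, b ≠ a → (Cmd.loop x (.write a ie e)).den n ρ α b = α b) ∧
      ∀ j, (Cmd.loop x (.write a ie e)).den n ρ α a j =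
        if off ≤ j ∧ j < off + n then val (j - off) else α a j := by
  refine iter_induction (I := fun k (β : Arrays) => (∀ b, b ≠ a → β b = α b) ∧
    ∀ j, β a j = if off ≤ j ∧ j < off + k then val (j - off) else α a j)
    ⟨fun _ _ => rfl, fun j => ?_⟩
    fun i hin β hβ => ⟨fun b hb => ?_, fun j => ?_⟩
  · rw [if_neg (by omega)]
  · ext j
    rw [Cmd.den, Arrays.set_apply, if_neg (by simp [hb]), hβ.1 b hb]
  · rw [Cmd.den, Arrays.set_apply, hi,
      he β i hin hβ.1 (by rw [hβ.2, if_neg (by omega)])]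
    by_cases hj : j = off + i
    · rw [if_pos ⟨rfl, hj⟩, if_pos (by omega), hj, Nat.add_sub_cancel_left]
    · rw [if_neg (by simp [hj]), hβ.2]
      by_cases h2 : off ≤ j ∧ j < off + i
      · rw [if_pos h2, if_pos (by omega)]
      · rw [if_neg h2, if_neg (by omega)]

/-- A double loop either makes progress `P`, or nothing happens and `Q` holds for all indices. -/
lemma iter_iter_progress {S : Type*} {f : ℕ → ℕ → S → S} {n : ℕ} {s : S} (I P E : S → Prop)
    (Q : ℕ → ℕ → Prop)
    (h : ∀ i < n, ∀ j < n, ∀ s, I s → I (f i j s) ∧ (P s → P (f i j s)) ∧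
      (E s → P (f i j s) ∨ (E (f i j s) ∧ Q i j))) (hI : I s) (hE : E s) :
    I (iter (fun i => iter (f i) n) n s) ∧ (P (iter (fun i => iter (f i) n) n s) ∨
      (E (iter (fun i => iter (f i) n) n s) ∧ ∀ i < n, ∀ j < n, Q i j)) := by
  refine iter_induction (I := fun k s => I s ∧ (P s ∨ (E s ∧ ∀ i < k, ∀ j < n, Q i j)))
    ⟨hI, Or.inr ⟨hE, by simp⟩⟩ fun i hi s hs => ?_
  have := iter_induction (f := f i) (n := n) (s := s)
    (I := fun k s => I s ∧ (P s ∨ (E s ∧ (∀ i' < i, ∀ j < n, Q i' j) ∧ ∀ j < k, Q i j)))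
    ⟨hs.1, hs.2.imp id fun h => ⟨h.1, h.2, by simp⟩⟩ fun j hj s hs => ?_
  · refine ⟨this.1, this.2.imp id fun h' => ⟨h'.1, fun i' hi' j hj => ?_⟩⟩
    rcases Nat.lt_succ_iff_lt_or_eq.1 hi' with hi' | rfl
    · exact h'.2.1 i' hi' j hj
    · exact h'.2.2 j hj
  · obtain ⟨h1, h2, h3⟩ := h i hi j hj s hs.1
    refine ⟨h1, ?_⟩
    rcases hs.2 with hP | ⟨hE, hQ, hQ'⟩
    · exact Or.inl (h2 hP)
    · refine (h3 hE).imp id fun h4 => ⟨h4.1, hQ, fun j' hj' => ?_⟩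
      rcases Nat.lt_succ_iff_lt_or_eq.1 hj' with hj' | rfl
      · exact hQ' j' hj'
      · exact h4.2

/-- Repeated passes lead to a final state, or the measure `ν` grows each time. -/
lemma iter_done {S : Type*} {g : ℕ → S → S} {n : ℕ} {s : S} (I D : S → Prop) (ν : S → ℕ)
    (h : ∀ i s, I s → I (g i s) ∧ (D s → D (g i s)) ∧ (D (g i s) ∨ ν s < ν (g i s))) (hI : I s) :
    I (iter g n s) ∧ (D (iter g n s) ∨ ν s + n ≤ ν (iter g n s)) := by
  refine iter_induction (I := fun k s' => I s' ∧ (D s' ∨ ν s + k ≤ ν s')) ⟨hI, Or.inr le_rfl⟩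
    fun i _ s hs => ?_
  obtain ⟨h1, h2, h3⟩ := h i s hs.1
  refine ⟨h1, ?_⟩
  rcases hs.2 with hD | hν
  · exact Or.inl (h2 hD)
  · exact h3.imp id fun h4 => by omega

/-! ### The merging program -/

open LExpr

/-- The test whether the vertex in variable `1` may be merged into the vertex in variable `2`.
Array `4` holds the remaining vertices and array `5` the side of the host tree. -/
def canMergeExpr : LExpr :=
  and (mem 4 1) <| and (mem 4 2) <| and (neg (eq (.var 1) (.var 2))) <|
    and (imp (mem 5 1) (mem 5 2)) <|
    and (imp (mem 5 1) (all 3 (imp (mem 4 3) (imp (adj 1 3) (adj 2 3))))) <|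
    imp (neg (mem 5 1)) (all 3 (imp (mem 4 3) (imp (adj 1 3) (eq (.var 3) (.var 2)))))

lemma isTrue_canMergeExpr {n : ℕ} {G : SimpleGraph (Fin n)} {α : Arrays} (hG : HasAdj G α)
    {ρ : ℕ → ℕ} {u v : Fin n} (hu : ρ 1 = u) (hv : ρ 2 = v) :
    canMergeExpr.IsTrue n α ρ ↔ CanMerge G (supp n α 5) (supp n α 4) u v := by
  simp only [canMergeExpr, isTrue_and, isTrue_imp, isTrue_neg, isTrue_all, isTrue_mem, isTrue_eq,
    isTrue_adj, LExpr.eval, Function.update_self, ne_eq, Nat.reduceEqDiff,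
    not_false_eq_true, Function.update_of_ne, OfNat.one_ne_ofNat, hu, hv]
  have e1 : ∀ x y : Fin n, ¬ α 0 (n * x + y) = 0 ↔ G.Adj x y := hG
  simp only [e1, Fin.val_inj]
  constructor
  · rintro ⟨h1, h2, h3, h4, h5, h6⟩
    exact ⟨by simpa using h1, by simpa using h2, h3, by simpa using h4,
      by simpa using h5, by simpa using h6⟩
  · rintro ⟨h1, h2, h3, h4, h5, h6⟩
    exact ⟨by simpa using h1, by simpa using h2, h3, by simpa using h4,
      by simpa using h5, by simpa using h6⟩

/-- Merge the vertex in variable `1` into the vertex in variable `2`: the nodes that array `3`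
assigns to them get a new common parent in array `2`. The number of nodes is in array `9`. -/
def mergeCmd : Cmd :=
  .seq (.write 2 (mem 3 1) (.read 9 (.const 0))) <|
  .seq (.write 2 (mem 3 2) (.read 9 (.const 0))) <|
  .seq (.write 3 (.var 2) (.read 9 (.const 0))) <|
  .seq (.write 9 (.const 0) (.add (.read 9 (.const 0)) (.const 1))) <|
  .write 4 (.var 1) (.const 0)

/-- The merging program: repeatedly merge vertices of the set in array `4`. -/
def mergeLoop : Cmd := .loop 0 (.loop 1 (.loop 2 (.ite canMergeExpr mergeCmd .skip)))

/-- Set up the leaves. -/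
def initForest : Cmd :=
  .seq (.write 9 (.const 0) .len) <|
  .seq (.loop 1 (.write 3 (.var 1) (.var 1))) <|
  .seq (.loop 1 (.write 2 (.var 1) (.add .len .len))) <|
  .loop 1 (.write 2 (.add .len (.var 1)) (.add .len .len))

section Merge

variable {n k : ℕ} {G : SimpleGraph (Fin n)} {ρ : ℕ → ℕ} {α β : Arrays} {A R₀ : Finset (Fin n)}

lemma den_mergeCmd {u v : Fin n} (hu : ρ 1 = u) (hv : ρ 2 = v) :
    (∀ a, a ≠ 2 → a ≠ 3 → a ≠ 4 → a ≠ 9 → mergeCmd.den n ρ α a = α a) ∧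
    supp n (mergeCmd.den n ρ α) 4 = (supp n α 4).erase u ∧
    mergeCmd.den n ρ α 2 =
      Function.update (Function.update (α 2) (α 3 u) (α 9 0)) (α 3 v) (α 9 0) ∧
    mergeCmd.den n ρ α 3 = Function.update (α 3) v (α 9 0) ∧
    mergeCmd.den n ρ α 9 0 = α 9 0 + 1 := by
  refine ⟨fun a h2 h3 h4 h9 => ?_, ?_, ?_, ?_, ?_⟩
  · ext i
    simp [mergeCmd, Cmd.den, Arrays.set_apply, h2, h3, h4, h9]
  · ext w
    by_cases hw : (w : ℕ) = u
    · simp [mergeCmd, Cmd.den, Arrays.set_apply, hu, LExpr.eval, hw, Fin.ext_iff]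
    · simp [mergeCmd, Cmd.den, Arrays.set_apply, hu, LExpr.eval, hw, Fin.ext_iff]
  · ext i
    simp [mergeCmd, Cmd.den, Arrays.set_apply, hu, hv, LExpr.eval, mem, Function.update_apply]
  · ext i
    simp [mergeCmd, Cmd.den, Arrays.set_apply, hu, hv, LExpr.eval, mem, Function.update_apply]
  · simp [mergeCmd, Cmd.den, Arrays.set_apply, hu, hv, LExpr.eval, mem]

/-- The invariant of the merging program. -/
structure MergeLoopInv (G : SimpleGraph (Fin n)) (k : ℕ) (β : Arrays) (A R₀ : Finset (Fin n))
    (α : Arrays) : Prop where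
  frame : ∀ a, a ≠ 2 → a ≠ 3 → a ≠ 4 → a ≠ 9 → α a = β a
  merge : MergeInv G A R₀ (supp n α 4)
  forest : R₀ = Finset.univ → (∀ v ∈ A, TraceWidthLE G k v) →
    ForestInv G k A (supp n α 4) (α 2) (α 3) (α 9 0)

lemma MergeLoopInv.supp_eq (h : MergeLoopInv G k β A R₀ α) (hA : A = supp n β 5) :
    supp n α 5 = A := by
  rw [hA]
  ext v
  rw [mem_supp, mem_supp, h.frame 5 (by norm_num) (by norm_num) (by norm_num) (by norm_num)]

lemma MergeLoopInv.hasAdj (h : MergeLoopInv G k β A R₀ α) (hG : HasAdj G β) : HasAdj G α := by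
  intro i j
  rw [h.frame 0 (by norm_num) (by norm_num) (by norm_num) (by norm_num)]
  exact hG i j

lemma MergeLoopInv.den_mergeCmd (h : MergeLoopInv G k β A R₀ α) (hs : IsSide G A R₀) (hk : 1 ≤ k)
    {u v : Fin n} (hu : ρ 1 = u) (hv : ρ 2 = v) (huv : CanMerge G A (supp n α 4) u v) :
    MergeLoopInv G k β A R₀ (mergeCmd.den n ρ α) := by
  obtain ⟨h1, h2, h3, h4, h5⟩ := TreeConvex.den_mergeCmd (n := n) (α := α) hu hv
  refine ⟨fun a a2 a3 a4 a9 => (h1 a a2 a3 a4 a9).trans (h.frame a a2 a3 a4 a9), ?_,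
    fun hR hw => ?_⟩
  · rw [h2]
    exact h.merge.erase hs huv
  · rw [h2, h3, h4, h5]
    subst hR
    exact (h.forest rfl hw).merge hk (fun x y => hs.cross x (Finset.mem_univ _) y) hw huv

/-- A pass without any merge leaves the state unchanged, so all its failed tests refer to one and
the same remaining set. -/
lemma den_mergePass (hG : HasAdj G β) (hA : A = supp n β 5) (hs : IsSide G A R₀) (hk : 1 ≤ k)
    (h : MergeLoopInv G k β A R₀ α) :
    MergeLoopInv G k β A R₀
      ((Cmd.loop 1 (.loop 2 (.ite canMergeExpr mergeCmd .skip))).den n ρ α) ∧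
    ((supp n ((Cmd.loop 1 (.loop 2 (.ite canMergeExpr mergeCmd .skip))).den n ρ α) 4).card <
      (supp n α 4).card ∨
    (supp n ((Cmd.loop 1 (.loop 2 (.ite canMergeExpr mergeCmd .skip))).den n ρ α) 4 =
      supp n α 4 ∧ ∀ u v, ¬ CanMerge G A (supp n α 4) u v)) := by
  have := iter_iter_progress (n := n) (s := α)
    (f := fun i j γ => (Cmd.ite canMergeExpr mergeCmd .skip).den n
      (Function.update (Function.update ρ 1 i) 2 j) γ)
    (MergeLoopInv G k β A R₀) (fun γ => (supp n γ 4).card < (supp n α 4).card) (fun γ => γ = α)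
    (fun i j => ∀ u v : Fin n, (u : ℕ) = i → (v : ℕ) = j → ¬ CanMerge G A (supp n α 4) u v)
    (fun i hi j hj γ hγ => ?_) h rfl
  · refine ⟨this.1, this.2.imp id fun h' => ⟨?_, fun u v => h'.2 u u.2 v v.2 u v rfl rfl⟩⟩
    exact congrArg (fun γ => supp n γ 4) h'.1
  · have hiff := isTrue_canMergeExpr (hγ.hasAdj hG) (u := ⟨i, hi⟩) (v := ⟨j, hj⟩)
      (ρ := Function.update (Function.update ρ 1 i) 2 j) (by simp) (by simp)
    rw [hγ.supp_eq hA] at hiff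
    by_cases hc : CanMerge G A (supp n γ 4) ⟨i, hi⟩ ⟨j, hj⟩
    · rw [Cmd.den_ite_of_isTrue (hiff.2 hc)]
      have hlt : (supp n (mergeCmd.den n (Function.update (Function.update ρ 1 i) 2 j) γ) 4).card <
          (supp n γ 4).card := by
        rw [(TreeConvex.den_mergeCmd (u := ⟨i, hi⟩) (v := ⟨j, hj⟩) (by simp) (by simp)).2.1]
        exact Finset.card_erase_lt_of_mem hc.left
      exact ⟨hγ.den_mergeCmd hs hk (by simp) (by simp) hc, fun h' => hlt.trans h',
        fun h' => Or.inl (by rwa [h'] at hlt ⊢)⟩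
    · rw [Cmd.den_ite_of_not fun h' => hc (hiff.1 h'), Cmd.den]
      refine ⟨hγ, id, fun h' => Or.inr ⟨h', ?_⟩⟩
      rintro u v rfl rfl
      rwa [h'] at hc

/-- In the dismantlable case a pass can be stuck only when at most one vertex is left. Otherwise it
loses a vertex, and since the set never becomes empty, `n` passes suffice. Conversely, a remainder
of at most one vertex is dismantlable, and the invariant carries this back to the start. -/
lemma den_mergeLoop (hG : HasAdj G β) (hA : A = supp n β 5) (hs : IsSide G A R₀) (hk : 1 ≤ k)
    (h : MergeLoopInv G k β A R₀ α) :
    MergeLoopInv G k β A R₀ (mergeLoop.den n ρ α) ∧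
      ((supp n (mergeLoop.den n ρ α) 4).card ≤ 1 ↔ Dismantlable G (R₀ ∩ A)) := by
  have hle : ∀ γ : Arrays, (supp n γ 4).card ≤ n := fun γ => by
    simpa using Finset.card_le_univ (supp n γ 4)
  have := iter_done (n := n) (s := α)
    (g := fun i γ => (Cmd.loop 1 (.loop 2 (.ite canMergeExpr mergeCmd .skip))).den n
      (Function.update ρ 0 i) γ)
    (MergeLoopInv G k β A R₀)
    (fun γ => Dismantlable G (R₀ ∩ A) → (supp n γ 4).card ≤ 1) (fun γ => n - (supp n γ 4).card)
    (fun i γ hγ => ?_) h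
  · refine ⟨this.1, fun hc => ?_, fun hd => ?_⟩
    · rw [← this.1.merge.dismantlable_iff]
      exact .base ((Finset.card_le_card Finset.inter_subset_left).trans hc)
    · rcases this.2 with h1 | h1
      · exact h1 hd
      · have := Finset.card_pos.2 this.1.merge.nonempty
        have := Finset.card_pos.2 h.merge.nonempty
        have := hle α
        omega
  · obtain ⟨h1, h2⟩ := den_mergePass (ρ := Function.update ρ 0 i) hG hA hs hk hγ
    have hγn := hle γ
    refine ⟨h1, fun h3 hd => ?_, ?_⟩
    · rcases h2 with h2 | h2
      · exact h2.le.trans (h3 hd)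
      · rw [h2.1]
        exact h3 hd
    · rcases h2 with h2 | h2
      · exact Or.inr (by omega)
      · left
        intro hd
        by_contra hc
        rw [h2.1] at hc
        obtain ⟨u, v, huv⟩ := hγ.merge.exists_canMerge hs hd (not_le.1 hc)
        exact h2.2 u v huv

end Merge

/-! ### Initial forest followed by the merging process. -/

section Elimination

variable {n k : ℕ} {G : SimpleGraph (Fin n)} {ρ : ℕ → ℕ} {α : Arrays} {A R₀ : Finset (Fin n)}

lemma den_initForest (ρ : ℕ → ℕ) (α : Arrays) :
    (∀ a, a ≠ 2 → a ≠ 3 → a ≠ 9 → initForest.den n ρ α a = α a) ∧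
    (∀ y < 2 * n, initForest.den n ρ α 2 y = 2 * n) ∧
    (∀ v < n, initForest.den n ρ α 3 v = v) ∧ initForest.den n ρ α 9 0 = n := by
  simp only [initForest, Cmd.den_seq]
  obtain ⟨h1, h1'⟩ := den_loop_write (n := n) (ρ := ρ) (a := 3) (x := 1) (off := 0)
    (ie := .var 1) (e := .var 1) (val := id) (α := (Cmd.write 9 (.const 0) .len).den n ρ α)
    (by simp [LExpr.eval]) (by simp [LExpr.eval])
  generalize (Cmd.loop 1 (.write 3 (.var 1) (.var 1))).den n ρ
    ((Cmd.write 9 (.const 0) .len).den n ρ α) = α₁ at *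
  obtain ⟨h2, h2'⟩ := den_loop_write (n := n) (ρ := ρ) (a := 2) (x := 1) (off := 0)
    (ie := .var 1) (e := .add .len .len) (val := fun _ => 2 * n) (α := α₁)
    (by simp [LExpr.eval]) (by simp [LExpr.eval, two_mul])
  generalize (Cmd.loop 1 (.write 2 (.var 1) (.add .len .len))).den n ρ α₁ = α₂ at *
  obtain ⟨h3, h3'⟩ := den_loop_write (n := n) (ρ := ρ) (a := 2) (x := 1) (off := n)
    (ie := .add .len (.var 1)) (e := .add .len .len) (val := fun _ => 2 * n) (α := α₂)
    (by simp [LExpr.eval]) (by simp [LExpr.eval, two_mul])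
  refine ⟨fun a a2 a3 a9 => ?_, fun y hy => ?_, fun v hv => ?_, ?_⟩
  · rw [h3 a a2, h2 a a2, h1 a a3]
    ext i
    simp [Cmd.den, Arrays.set_apply, a9]
  · rw [h3']
    split_ifs
    · rfl
    · rw [h2', if_pos (by omega)]
  · rw [h3 3 (by norm_num), h2 3 (by norm_num), h1', if_pos (by omega)]
    simp
  · rw [h3 9 (by norm_num), h2 9 (by norm_num), h1 9 (by norm_num)]
    simp [Cmd.den, Arrays.set_apply, LExpr.eval]

/-- The elimination of the set in array `4` with respect to the side in array `5`. -/
def elimination : Cmd := .seq initForest mergeLoop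

/-- This serves two purposes: on a component it only tests dismantlability and its forest is
discarded, while on the whole vertex set it builds the decomposition. -/
lemma den_elimination (hG : HasAdj G α) (hA : supp n α 5 = A) (hR : supp n α 4 = R₀)
    (hne : R₀.Nonempty) (hs : IsSide G A R₀) (hk : 1 ≤ k) :
    (∀ a, a ≠ 2 → a ≠ 3 → a ≠ 4 → a ≠ 9 → elimination.den n ρ α a = α a) ∧
    ((supp n (elimination.den n ρ α) 4).card ≤ 1 ↔ Dismantlable G (R₀ ∩ A)) ∧
    (supp n (elimination.den n ρ α) 4).Nonempty ∧
    (R₀ = Finset.univ → (∀ v ∈ A, TraceWidthLE G k v) →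
      ForestInv G k A (supp n (elimination.den n ρ α) 4) (elimination.den n ρ α 2)
        (elimination.den n ρ α 3) (elimination.den n ρ α 9 0)) := by
  obtain ⟨h1, h2, h3, h4⟩ := den_initForest (n := n) ρ α
  have hsupp : supp n (initForest.den n ρ α) 4 = R₀ := by
    rw [← hR]
    ext v
    rw [mem_supp, mem_supp, h1 4 (by norm_num) (by norm_num) (by norm_num)]
  have hinv : MergeLoopInv G k α A R₀ (initForest.den n ρ α) := by
    refine ⟨fun a a2 a3 _ a9 => h1 a a2 a3 a9, ?_, fun hu _ => ?_⟩
    · rw [hsupp]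
      exact mergeInv_refl hne
    · rw [hsupp, h4]
      subst hu
      exact forestInv_init hk (fun x y => hs.cross x (Finset.mem_univ _) y) h2 h3
  obtain ⟨h5, h6⟩ := den_mergeLoop (ρ := ρ) hG hA.symm hs hk hinv
  exact ⟨h5.frame, h6, h5.merge.nonempty, h5.forest⟩

end Elimination

/-! ### Computing the sides of a component -/

/-- One step of the computation of the side in array `5` and the opposite side in array `6`. -/
def sidesStep : Cmd :=
  .seq (.ite (and (adj 1 2) (mem 5 1)) (.write 6 (.var 2) (.const 1)) .skip)
    (.ite (and (adj 1 2) (mem 6 1)) (.write 5 (.var 2) (.const 1)) .skip)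

/-- Compute the sides of the component of the vertex in variable `10`. -/
def sides : Cmd :=
  .seq (.loop 1 (.write 5 (.var 1) (eq (.var 1) (.var 10)))) <|
  .seq (.loop 1 (.write 6 (.var 1) (.const 0))) <|
  .loop 0 (.loop 1 (.loop 2 sidesStep))

section Sides

variable {n : ℕ} {G : SimpleGraph (Fin n)} {ρ : ℕ → ℕ} {α β : Arrays} {P Q : Finset (Fin n)}

/-- The invariant of the computation of the sides. -/
structure SidesInv (β : Arrays) (P Q : Finset (Fin n)) (w : Fin n) (α : Arrays) : Prop where
  frame : ∀ a, a ≠ 5 → a ≠ 6 → α a = β a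
  left : supp n α 5 ⊆ P
  right : supp n α 6 ⊆ Q
  start : w ∈ supp n α 5

/-- The sides are closed under adjacency. -/
def SidesClosed (G : SimpleGraph (Fin n)) (α : Arrays) : Prop :=
  ∀ u v, G.Adj u v → (u ∈ supp n α 5 → v ∈ supp n α 6) ∧ (u ∈ supp n α 6 → v ∈ supp n α 5)

lemma supp_set_one {a v : ℕ} (hv : v < n) :
    supp n (α.set a v 1) a = insert ⟨v, hv⟩ (supp n α a) := by
  ext w
  by_cases hw : (w : ℕ) = v <;> simp [Arrays.set_apply, hw, Fin.ext_iff]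

lemma supp_set_of_ne {a b v x : ℕ} (h : b ≠ a) : supp n (α.set a v x) b = supp n α b := by
  ext w
  simp [Arrays.set_apply, h]

lemma supp_congr {a : ℕ} (h : α a = β a) : supp n α a = supp n β a := by
  ext w
  simp [h]

lemma den_sidesStep {w u v : Fin n} (hG : HasAdj G β)
    (hPQ : ∀ x ∈ P, ∀ y, G.Adj x y → y ∈ Q) (hQP : ∀ x ∈ Q, ∀ y, G.Adj x y → y ∈ P)
    (hu : ρ 1 = u) (hv : ρ 2 = v) (h : SidesInv β P Q w α) :
    SidesInv β P Q w (sidesStep.den n ρ α) ∧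
    supp n α 5 ⊆ supp n (sidesStep.den n ρ α) 5 ∧ supp n α 6 ⊆ supp n (sidesStep.den n ρ α) 6 ∧
    (supp n (sidesStep.den n ρ α) 5 = supp n α 5 → supp n (sidesStep.den n ρ α) 6 = supp n α 6 →
      G.Adj u v → (u ∈ supp n α 5 → v ∈ supp n α 6) ∧ (u ∈ supp n α 6 → v ∈ supp n α 5)) := by
  have h1 : SidesInv β P Q w ((Cmd.ite (and (adj 1 2) (mem 5 1))
      (.write 6 (.var 2) (.const 1)) .skip).den n ρ α) ∧
      supp n ((Cmd.ite (and (adj 1 2) (mem 5 1))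
        (.write 6 (.var 2) (.const 1)) .skip).den n ρ α) 5 = supp n α 5 ∧
      supp n α 6 ⊆ supp n ((Cmd.ite (and (adj 1 2) (mem 5 1))
        (.write 6 (.var 2) (.const 1)) .skip).den n ρ α) 6 ∧
      (G.Adj u v → u ∈ supp n α 5 → v ∈ supp n ((Cmd.ite (and (adj 1 2) (mem 5 1))
        (.write 6 (.var 2) (.const 1)) .skip).den n ρ α) 6) := by
    have hiff : (and (adj 1 2) (mem 5 1)).IsTrue n α ρ ↔ G.Adj u v ∧ u ∈ supp n α 5 := by
      rw [isTrue_and, isTrue_adj, isTrue_mem, hu, hv, mem_supp,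
        h.frame 0 (by norm_num) (by norm_num), hG]
    by_cases hc : G.Adj u v ∧ u ∈ supp n α 5
    · rw [Cmd.den_ite_of_isTrue (hiff.2 hc)]
      simp only [Cmd.den, LExpr.eval, hv]
      rw [supp_set_one v.2, supp_set_of_ne (by norm_num)]
      refine ⟨⟨fun a a5 a6 => ?_, ?_, ?_, ?_⟩, rfl, Finset.subset_insert _ _, fun _ _ => by simp⟩
      · rw [← h.frame a a5 a6]
        ext i
        simp [Arrays.set_apply, a6]
      · rw [supp_set_of_ne (by norm_num)]
        exact h.left
      · rw [supp_set_one v.2]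
        exact Finset.insert_subset (hPQ u (h.left hc.2) v hc.1) h.right
      · rw [supp_set_of_ne (by norm_num)]
        exact h.start
    · rw [Cmd.den_ite_of_not fun h' => hc (hiff.1 h')]
      exact ⟨h, rfl, subset_rfl, fun h1 h2 => absurd ⟨h1, h2⟩ hc⟩
  rw [sidesStep, Cmd.den]
  generalize (Cmd.ite (and (adj 1 2) (mem 5 1))
    (.write 6 (.var 2) (.const 1)) .skip).den n ρ α = γ at h1 ⊢
  obtain ⟨h, h5, h6, h7⟩ := h1
  have hiff : (and (adj 1 2) (mem 6 1)).IsTrue n γ ρ ↔ G.Adj u v ∧ u ∈ supp n γ 6 := by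
    rw [isTrue_and, isTrue_adj, isTrue_mem, hu, hv, mem_supp,
      h.frame 0 (by norm_num) (by norm_num), hG]
  by_cases hc : G.Adj u v ∧ u ∈ supp n γ 6
  · rw [Cmd.den_ite_of_isTrue (hiff.2 hc)]
    simp only [Cmd.den, LExpr.eval, hv]
    rw [supp_set_one v.2, supp_set_of_ne (by norm_num)]
    refine ⟨⟨fun a a5 a6 => ?_, ?_, ?_, ?_⟩, ?_, h6,
      fun e1 e2 hadj => ⟨fun hu5 => ?_, fun hu6 => ?_⟩⟩
    · rw [← h.frame a a5 a6]
      ext i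
      simp [Arrays.set_apply, a5]
    · rw [supp_set_one v.2]
      exact Finset.insert_subset (hQP u (h.right hc.2) v hc.1) h.left
    · rw [supp_set_of_ne (by norm_num)]
      exact h.right
    · rw [supp_set_one v.2]
      exact Finset.mem_insert_of_mem h.start
    · rw [h5]
      exact Finset.subset_insert _ _
    · rw [← e2]
      exact h7 hadj hu5
    · rw [← e1]
      simp
  · rw [Cmd.den_ite_of_not fun h' => hc (hiff.1 h'), Cmd.den]
    refine ⟨h, h5.ge, h6, fun e1 e2 hadj => ⟨fun hu5 => e2 ▸ h7 hadj hu5, fun hu6 => ?_⟩⟩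
    rw [← e2] at hu6
    exact absurd ⟨hadj, hu6⟩ hc

lemma den_sidesPass {w : Fin n} (hG : HasAdj G β)
    (hPQ : ∀ x ∈ P, ∀ y, G.Adj x y → y ∈ Q) (hQP : ∀ x ∈ Q, ∀ y, G.Adj x y → y ∈ P)
    (h : SidesInv β P Q w α) :
    SidesInv β P Q w ((Cmd.loop 1 (.loop 2 sidesStep)).den n ρ α) ∧
    supp n α 5 ⊆ supp n ((Cmd.loop 1 (.loop 2 sidesStep)).den n ρ α) 5 ∧
    supp n α 6 ⊆ supp n ((Cmd.loop 1 (.loop 2 sidesStep)).den n ρ α) 6 ∧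
    ((supp n α 5).card + (supp n α 6).card <
      (supp n ((Cmd.loop 1 (.loop 2 sidesStep)).den n ρ α) 5).card +
      (supp n ((Cmd.loop 1 (.loop 2 sidesStep)).den n ρ α) 6).card ∨
      (supp n ((Cmd.loop 1 (.loop 2 sidesStep)).den n ρ α) 5 = supp n α 5 ∧
      supp n ((Cmd.loop 1 (.loop 2 sidesStep)).den n ρ α) 6 = supp n α 6 ∧ SidesClosed G α)) := by
  have := iter_iter_progress (n := n) (s := α)
    (f := fun i j γ => sidesStep.den n (Function.update (Function.update ρ 1 i) 2 j) γ)
    (fun γ => SidesInv β P Q w γ ∧ supp n α 5 ⊆ supp n γ 5 ∧ supp n α 6 ⊆ supp n γ 6)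
    (fun γ => (supp n α 5).card + (supp n α 6).card < (supp n γ 5).card + (supp n γ 6).card)
    (fun γ => supp n γ 5 = supp n α 5 ∧ supp n γ 6 = supp n α 6)
    (fun i j => ∀ u v : Fin n, (u : ℕ) = i → (v : ℕ) = j → G.Adj u v →
      (u ∈ supp n α 5 → v ∈ supp n α 6) ∧ (u ∈ supp n α 6 → v ∈ supp n α 5))
    (fun i hi j hj γ hγ => ?_) ⟨h, subset_rfl, subset_rfl⟩ ⟨rfl, rfl⟩
  · exact ⟨this.1.1, this.1.2.1, this.1.2.2, this.2.imp id fun h' =>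
      ⟨h'.1.1, h'.1.2, fun u v => h'.2 u u.2 v v.2 u v rfl rfl⟩⟩
  · obtain ⟨h1, h2, h3, h4⟩ := den_sidesStep (u := ⟨i, hi⟩) (v := ⟨j, hj⟩)
      (ρ := Function.update (Function.update ρ 1 i) 2 j) hG hPQ hQP (by simp) (by simp) hγ.1
    have c2 := Finset.card_le_card h2
    have c3 := Finset.card_le_card h3
    refine ⟨⟨h1, hγ.2.1.trans h2, hγ.2.2.trans h3⟩, fun h' => by omega, fun h' => ?_⟩
    simp only [h'.1, h'.2] at h2 h3 h4 c2 c3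
    by_cases hlt : (supp n α 5).card + (supp n α 6).card <
        (supp n (sidesStep.den n (Function.update (Function.update ρ 1 i) 2 j) γ) 5).card +
        (supp n (sidesStep.den n (Function.update (Function.update ρ 1 i) 2 j) γ) 6).card
    · exact Or.inl hlt
    · have e5 := Finset.eq_of_subset_of_card_le h2 (by omega)
      have e6 := Finset.eq_of_subset_of_card_le h3 (by omega)
      refine Or.inr ⟨⟨e5.symm, e6.symm⟩, ?_⟩
      rintro u v rfl rfl
      exact h4 e5.symm e6.symm

/-- The sets `P` and `Q` exist only in the proof: they confine the search from `w`, and their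
disjointness keeps the two computed sides apart. -/
lemma den_sides {w : Fin n} (hG : HasAdj G α) (hPQ : ∀ x ∈ P, ∀ y, G.Adj x y → y ∈ Q)
    (hQP : ∀ x ∈ Q, ∀ y, G.Adj x y → y ∈ P) (hd : Disjoint P Q) (hw : w ∈ P) (hρ : ρ 10 = w) :
    SidesInv α P Q w (sides.den n ρ α) ∧ SidesClosed G (sides.den n ρ α) := by
  simp only [sides, Cmd.den_seq]
  obtain ⟨h1, h1'⟩ := den_loop_write (n := n) (ρ := ρ) (a := 5) (x := 1) (off := 0)
    (ie := .var 1) (e := eq (.var 1) (.var 10)) (val := fun i => if i = w then 1 else 0) (α := α)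
    (by simp [LExpr.eval]) (fun β i _ _ _ => by
      simp only [eq, neg, LExpr.eval, Function.update_self]
      rw [Function.update_of_ne (by norm_num), hρ]
      split_ifs <;> omega)
  generalize (Cmd.loop 1 (.write 5 (.var 1) (eq (.var 1) (.var 10)))).den n ρ α = α₁ at *
  obtain ⟨h2, h2'⟩ := den_loop_write (n := n) (ρ := ρ) (a := 6) (x := 1) (off := 0)
    (ie := .var 1) (e := .const 0) (val := fun _ => 0) (α := α₁)
    (by simp [LExpr.eval]) (by simp [LExpr.eval])
  generalize (Cmd.loop 1 (.write 6 (.var 1) (.const 0))).den n ρ α₁ = α₂ at *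
  have hinit : SidesInv α P Q w α₂ := by
    have h5 : supp n α₂ 5 = {w} := by
      ext v
      rw [mem_supp, h2 5 (by norm_num), h1', if_pos (by omega)]
      simp [Fin.ext_iff]
    have h6 : supp n α₂ 6 = ∅ := by
      ext v
      rw [mem_supp, h2', if_pos (by omega)]
      simp
    refine ⟨fun a a5 a6 => by rw [h2 a a6, h1 a a5], ?_, ?_, ?_⟩
    · rw [h5]; simpa using hw
    · rw [h6]; simp
    · rw [h5]; simp
  have hpass : ∀ i γ, SidesInv α P Q w γ →
      SidesInv α P Q w ((Cmd.loop 1 (.loop 2 sidesStep)).den n (Function.update ρ 0 i) γ) ∧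
      (SidesClosed G γ →
        SidesClosed G ((Cmd.loop 1 (.loop 2 sidesStep)).den n (Function.update ρ 0 i) γ)) ∧
      (SidesClosed G ((Cmd.loop 1 (.loop 2 sidesStep)).den n (Function.update ρ 0 i) γ) ∨
        (supp n γ 5).card + (supp n γ 6).card <
        (supp n ((Cmd.loop 1 (.loop 2 sidesStep)).den n (Function.update ρ 0 i) γ) 5).card +
        (supp n ((Cmd.loop 1 (.loop 2 sidesStep)).den n (Function.update ρ 0 i) γ) 6).card) := by
    intro i γ hγ
    obtain ⟨h3, h4, h5, h6⟩ := den_sidesPass (ρ := Function.update ρ 0 i) hG hPQ hQP hγ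
    refine ⟨h3, fun hc => ?_, ?_⟩
    -- Closed sides can themselves play the roles of `P` and `Q`, so a further pass adds nothing.
    · obtain ⟨h7, -⟩ := den_sidesPass (ρ := Function.update ρ 0 i) (P := supp n γ 5)
        (Q := supp n γ 6) hG (fun x hx y hxy => (hc x y hxy).1 hx)
        (fun x hx y hxy => (hc x y hxy).2 hx) ⟨hγ.frame, subset_rfl, subset_rfl, hγ.start⟩
      intro u v huv
      rw [h7.left.antisymm h4, h7.right.antisymm h5]
      exact hc u v huv
    · refine h6.symm.imp (fun h7 u v huv => ?_) id
      rw [h7.1, h7.2.1]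
      exact h7.2.2 u v huv
  have := iter_done (n := n) (s := α₂)
    (g := fun i γ => (Cmd.loop 1 (.loop 2 sidesStep)).den n (Function.update ρ 0 i) γ)
    (SidesInv α P Q w) (SidesClosed G) (fun γ => (supp n γ 5).card + (supp n γ 6).card) hpass hinit
  refine ⟨this.1, this.2.resolve_right fun hle => ?_⟩
  -- The disjoint sides start with at least one vertex and never exceed `n` in total, so they cannot
  -- grow in all `n` passes.
  have h3 := Finset.card_pos.2 ⟨w, hinit.start⟩
  have h4 := Finset.card_union_of_disjoint (hd.mono this.1.left this.1.right)
  have h5 := Finset.card_le_univ (supp n (iter (fun i γ => (Cmd.loop 1 (.loop 2 sidesStep)).den n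
    (Function.update ρ 0 i) γ) n α₂) 5 ∪ supp n (iter (fun i γ =>
      (Cmd.loop 1 (.loop 2 sidesStep)).den n (Function.update ρ 0 i) γ) n α₂) 6)
  rw [Fintype.card_fin] at h5
  omega

end Sides

/-! ### Choosing the sides -/

/-- The traces of the vertices in variables `x` and `y` on the neighbourhood of the vertex in
variable `1` differ: the first is not contained in the second. -/
def traceNotLe (x y : ℕ) : LExpr := ex 3 (and (adj 1 3) (and (adj 3 x) (neg (adj 3 y))))

/-- The trace width of the vertex in variable `1` exceeds `k`. -/
def wideTrace (k : ℕ) : LExpr :=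
  exs (conj (fun i => conj (fun j => if i = j then .const 1 else traceNotLe (20 + i) (20 + j))
    (k + 1)) (k + 1)) 20 (k + 1)

/-- At most one vertex remains, and all trace widths on the side in array `5` are at most `k`. -/
def acceptExpr (k : ℕ) : LExpr :=
  and (all 1 (all 2 (imp (mem 4 1) (imp (mem 4 2) (eq (.var 1) (.var 2))))))
    (all 1 (imp (mem 5 1) (neg (wideTrace k))))

/-- Add the sides in arrays `5` and `6` to the chosen side in array `7` and the set of processed
vertices in array `8`. -/
def commitSides : Cmd :=
  .seq (.loop 1 (.write 7 (.var 1) (.add (mem 7 1) (mem 5 1))))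
    (.loop 1 (.write 8 (.var 1) (.add (mem 8 1) (.add (mem 5 1) (mem 6 1)))))

/-- Process the component of the vertex in variable `10`, with this vertex in the host tree. -/
def tryVertex (k : ℕ) : Cmd :=
  .ite (neg (mem 8 10))
    (.seq sides <| .seq (.loop 1 (.write 4 (.var 1) (.add (mem 5 1) (mem 6 1)))) <|
      .seq elimination <| .ite (acceptExpr k) commitSides .skip)
    .skip

section Choice

variable {n k : ℕ} {G : SimpleGraph (Fin n)} {ρ : ℕ → ℕ} {α β : Arrays}

/-- Too large an antichain contains one of size exactly `k + 1`, which the bound variables from `20`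
on can hold. Their distinctness need not be tested, since incomparable traces belong to different
vertices. -/
lemma isTrue_wideTrace (hG : HasAdj G α) {r : Fin n} (hr : ρ 1 = r) :
    (wideTrace k).IsTrue n α ρ ↔ ¬ TraceWidthLE G k r := by
  have hinc : ∀ g : ℕ → ℕ, (∀ i < k + 1, g i < n) → ∀ i (_ : i < k + 1) j (_ : j < k + 1),
      ∀ x y : Fin n, g i = x → g j = y →
      ((traceNotLe (20 + i) (20 + j)).IsTrue n α
        (fun x => if 20 ≤ x ∧ x < 20 + (k + 1) then g (x - 20) else ρ x) ↔
      ∃ b, G.Adj r b ∧ G.Adj b x ∧ ¬ G.Adj b y) := by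
    intro g hg i hi j hj x y hx hy
    rw [traceNotLe, isTrue_ex]
    refine exists_congr fun b => ?_
    simp only [isTrue_and, isTrue_neg, isTrue_adj, Function.update_self]
    rw [Function.update_of_ne (by norm_num), Function.update_of_ne (by omega),
      Function.update_of_ne (by omega), if_neg (by norm_num), if_pos (by omega), if_pos (by omega),
      Nat.add_sub_cancel_left, Nat.add_sub_cancel_left, hr, hx, hy, hG, hG, hG]
  rw [wideTrace, isTrue_exs]
  simp only [isTrue_conj]
  constructor
  · rintro ⟨g, hg, h⟩ hw
    let f : Fin (k + 1) → Fin n := fun i => ⟨g i, hg i i.2⟩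
    have hf : ∀ i j : Fin (k + 1), i ≠ j → ∃ b, G.Adj r b ∧ G.Adj b (f i) ∧ ¬ G.Adj b (f j) := by
      intro i j hij
      have := h i i.2 j j.2
      rw [if_neg (fun he => hij (Fin.ext he))] at this
      exact (hinc g hg i i.2 j j.2 (f i) (f j) rfl rfl).1 this
    have hinj : Function.Injective f := fun i j hij => by
      by_contra hne
      obtain ⟨b, -, h1, h2⟩ := hf i j hne
      rw [hij] at h1
      exact h2 h1
    have := hw (Finset.univ.image f) fun x hx y hy hxy => by
      simp only [Finset.mem_image, Finset.mem_univ, true_and] at hx hy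
      obtain ⟨i, rfl⟩ := hx
      obtain ⟨j, rfl⟩ := hy
      exact hf i j fun he => hxy (by rw [he])
    rw [Finset.card_image_of_injective _ hinj, Finset.card_univ, Fintype.card_fin] at this
    omega
  · intro h
    rw [TraceWidthLE] at h
    push Not at h
    obtain ⟨K, hK, hcard⟩ := h
    obtain ⟨K', hK', hcard'⟩ := Finset.exists_subset_card_eq (s := K) (n := k + 1) hcard
    let e := (K'.equivFinOfCardEq hcard').symm
    let g : ℕ → ℕ := fun i => if hi : i < k + 1 then (e ⟨i, hi⟩ : Fin n) else 0
    have hge : ∀ i (hi : i < k + 1), g i = (e ⟨i, hi⟩ : Fin n) := fun i hi => dif_pos hi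
    have hg : ∀ i < k + 1, g i < n := fun i hi => by
      rw [hge i hi]
      exact Fin.is_lt _
    refine ⟨g, hg, fun i hi j hj => ?_⟩
    by_cases hij : i = j
    · rw [if_pos hij]
      simp [IsTrue, LExpr.eval]
    · rw [if_neg hij]
      refine (hinc g hg i hi j hj _ _ (hge i hi) (hge j hj)).2
        (hK _ (hK' (e _).2) _ (hK' (e _).2) fun he => hij ?_)
      simpa using e.injective (Subtype.ext he)

lemma isTrue_acceptExpr (hG : HasAdj G α) : (acceptExpr k).IsTrue n α ρ ↔
    (supp n α 4).card ≤ 1 ∧ ∀ r ∈ supp n α 5, TraceWidthLE G k r := by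
  rw [acceptExpr, isTrue_and]
  refine and_congr ?_ ?_
  · simp only [isTrue_all, isTrue_imp, isTrue_mem, isTrue_eq, LExpr.eval, Function.update_self,
      ne_eq, OfNat.one_ne_ofNat, not_false_eq_true, Function.update_of_ne]
    rw [Finset.card_le_one]
    simp only [mem_supp, Fin.val_inj]
    exact ⟨fun h a ha b hb => h a b ha hb, fun h a b ha hb => h a ha b hb⟩
  · rw [isTrue_all]
    refine forall_congr' fun r => ?_
    rw [isTrue_imp, isTrue_neg, isTrue_mem, isTrue_wideTrace hG (Function.update_self ..), mem_supp,
      not_not, Function.update_self]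

lemma den_commitSides (ρ : ℕ → ℕ) (α : Arrays) :
    (∀ a, a ≠ 7 → a ≠ 8 → commitSides.den n ρ α a = α a) ∧
    supp n (commitSides.den n ρ α) 7 = supp n α 7 ∪ supp n α 5 ∧
    supp n (commitSides.den n ρ α) 8 = supp n α 8 ∪ (supp n α 5 ∪ supp n α 6) := by
  rw [commitSides, Cmd.den_seq]
  obtain ⟨h1, h1'⟩ := den_loop_write (n := n) (ρ := ρ) (a := 7) (x := 1) (off := 0) (α := α)
    (ie := .var 1) (e := .add (mem 7 1) (mem 5 1)) (val := fun i => α 7 i + α 5 i)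
    -- The loop reads the very cell that it is about to overwrite; `hi` says that this cell still
    -- has its original content.
    (by simp [LExpr.eval]) (fun γ i _ hγ hi => by
      rw [Nat.zero_add] at hi
      simp [LExpr.eval, mem, hγ 5, hi])
  generalize (Cmd.loop 1 (.write 7 (.var 1) (.add (mem 7 1) (mem 5 1)))).den n ρ α = α₁ at *
  obtain ⟨h2, h2'⟩ := den_loop_write (n := n) (ρ := ρ) (a := 8) (x := 1) (off := 0) (α := α₁)
    (ie := .var 1) (e := .add (mem 8 1) (.add (mem 5 1) (mem 6 1)))
    (val := fun i => α₁ 8 i + (α₁ 5 i + α₁ 6 i))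
    (by simp [LExpr.eval]) (fun γ i _ hγ hi => by
      rw [Nat.zero_add] at hi
      simp [LExpr.eval, mem, hγ 5, hγ 6, hi])
  refine ⟨fun a a7 a8 => by rw [h2 a a8, h1 a a7], ?_, ?_⟩
  · ext v
    rw [mem_supp, h2 7 (by norm_num), h1', if_pos (by omega)]
    simp only [Finset.mem_union, mem_supp, Nat.sub_zero]
    omega
  · ext v
    rw [mem_supp, h2', if_pos (by omega), h1 8 (by norm_num), h1 5 (by norm_num),
      h1 6 (by norm_num)]
    simp only [Finset.mem_union, mem_supp, Nat.sub_zero]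
    omega

/-- The invariant of the choice of the sides: array `7` is a good side of the union of components
in array `8`. -/
structure ChoiceInv (G : SimpleGraph (Fin n)) (k : ℕ) (A₀ : Finset (Fin n)) (β : Arrays) (i : ℕ)
    (α : Arrays) : Prop where
  frame : α 0 = β 0
  side : IsSide G (supp n α 7) (supp n α 8)
  subset : supp n α 7 ⊆ supp n α 8
  dismantlable : Dismantlable G (supp n α 7)
  width : ∀ r ∈ supp n α 7, TraceWidthLE G k r
  processed : ∀ v ∈ A₀, (v : ℕ) < i → v ∈ supp n α 8

lemma ChoiceInv.hasAdj {A₀ : Finset (Fin n)} {i : ℕ} (h : ChoiceInv G k A₀ β i α)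
    (hG : HasAdj G β) : HasAdj G α := by
  intro i j
  rw [h.frame]
  exact hG i j

lemma ChoiceInv.succ {A₀ : Finset (Fin n)} {w : Fin n} (h : ChoiceInv G k A₀ β w α)
    (hw : w ∈ A₀ → w ∈ supp n α 8) : ChoiceInv G k A₀ β (w + 1) α :=
  { h with
    processed := fun v hv hlt => by
      rcases Nat.lt_succ_iff_lt_or_eq.1 hlt with hlt | he
      · exact h.processed v hv hlt
      · obtain rfl : v = w := Fin.ext he
        exact hw hv }

lemma ChoiceInv.congr {A₀ : Finset (Fin n)} {i : ℕ} {γ : Arrays} (h : ChoiceInv G k A₀ β i α)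
    (h0 : γ 0 = α 0) (h7 : γ 7 = α 7) (h8 : γ 8 = α 8) : ChoiceInv G k A₀ β i γ := by
  have e7 : supp n γ 7 = supp n α 7 := supp_congr h7
  have e8 : supp n γ 8 = supp n α 8 := supp_congr h8
  exact ⟨h0.trans h.frame, by rw [e7, e8]; exact h.side, by rw [e7, e8]; exact h.subset,
    by rw [e7]; exact h.dismantlable, by rw [e7]; exact h.width, by rw [e8]; exact h.processed⟩

/-- The unknown good side `A₀` only guarantees success. If `w ∈ A₀` is unprocessed, the computed
side is the part of `A₀` in the component and passes both tests. Accepting a side that is not part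
of `A₀` does no harm, because the tests establish all that is needed. -/
lemma den_tryVertex {A₀ : Finset (Fin n)} (hG : HasAdj G β) (hk : 1 ≤ k)
    (hA₀ : IsSide G A₀ Finset.univ) (hd : Dismantlable G A₀) (hA₀w : ∀ r ∈ A₀, TraceWidthLE G k r)
    {w : Fin n} (hρ : ρ 10 = w) (h : ChoiceInv G k A₀ β w α) :
    ChoiceInv G k A₀ β (w + 1) ((tryVertex k).den n ρ α) := by
  have hwiff : (neg (mem 8 10)).IsTrue n α ρ ↔ w ∉ supp n α 8 := by
    rw [isTrue_neg, isTrue_mem, hρ, mem_supp]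
  by_cases hw8 : w ∈ supp n α 8
  · rw [tryVertex, Cmd.den_ite_of_not fun h' => hwiff.1 h' hw8]
    exact h.succ fun _ => hw8
  rw [tryVertex, Cmd.den_ite_of_isTrue (hwiff.2 hw8)]
  simp only [Cmd.den_seq]
  have hα := h.hasAdj hG
  have hout : ∀ x y, G.Adj x y → x ∉ supp n α 8 → y ∉ supp n α 8 :=
    fun x y hxy hx hy => hx (h.side.closed y hy x hxy.symm)
  have hcross : ∀ x y, G.Adj x y → (x ∈ A₀ ↔ y ∉ A₀) := fun x => hA₀.cross x (Finset.mem_univ _)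
  -- the sides of the component
  let P : Finset (Fin n) := Finset.univ.filter fun x => x ∉ supp n α 8 ∧ (x ∈ A₀ ↔ w ∈ A₀)
  let Q : Finset (Fin n) := Finset.univ.filter fun x => x ∉ supp n α 8 ∧ (x ∈ A₀ ↔ w ∉ A₀)
  have hP : ∀ x, x ∈ P ↔ x ∉ supp n α 8 ∧ (x ∈ A₀ ↔ w ∈ A₀) := fun x => by
    simp only [P, Finset.mem_filter, Finset.mem_univ, true_and]
  have hQ : ∀ x, x ∈ Q ↔ x ∉ supp n α 8 ∧ (x ∈ A₀ ↔ w ∉ A₀) := fun x => by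
    simp only [Q, Finset.mem_filter, Finset.mem_univ, true_and]
  obtain ⟨hinv, hclosed⟩ := den_sides (P := P) (Q := Q) (w := w) (ρ := ρ) hα
    (fun x hx y hxy => by
      rw [hP] at hx
      rw [hQ]
      have := hcross x y hxy
      exact ⟨hout x y hxy hx.1, by tauto⟩)
    (fun x hx y hxy => by
      rw [hQ] at hx
      rw [hP]
      have := hcross x y hxy
      exact ⟨hout x y hxy hx.1, by tauto⟩)
    (Finset.disjoint_left.2 fun x hx hx' => by
      rw [hP] at hx
      rw [hQ] at hx'
      tauto)
    ((hP w).2 ⟨hw8, Iff.rfl⟩) hρ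
  have hdisj : ∀ x, x ∈ supp n (sides.den n ρ α) 5 → x ∉ supp n (sides.den n ρ α) 6 :=
    fun x hx hx' => by
      have h1 := (hP x).1 (hinv.left hx)
      have h2 := (hQ x).1 (hinv.right hx')
      tauto
  have hα' := h.congr (hinv.frame 0 (by norm_num) (by norm_num))
    (hinv.frame 7 (by norm_num) (by norm_num)) (hinv.frame 8 (by norm_num) (by norm_num))
  have hout' : ∀ x, x ∈ supp n (sides.den n ρ α) 5 ∨ x ∈ supp n (sides.den n ρ α) 6 →
      x ∉ supp n (sides.den n ρ α) 8 := by
    rw [supp_congr (hinv.frame 8 (by norm_num) (by norm_num))]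
    rintro x (hx | hx)
    · exact ((hP x).1 (hinv.left hx)).1
    · exact ((hQ x).1 (hinv.right hx)).1
  have hside : ∀ x ∈ supp n (sides.den n ρ α) 5, (x ∈ A₀ ↔ w ∈ A₀) :=
    fun x hx => ((hP x).1 (hinv.left hx)).2
  have hside' : ∀ x ∈ supp n (sides.den n ρ α) 6, (x ∈ A₀ ↔ w ∉ A₀) :=
    fun x hx => ((hQ x).1 (hinv.right hx)).2
  have hstart := hinv.start
  clear hinv
  generalize sides.den n ρ α = α₁ at *
  clear h hwiff hw8 hα hout P Q hP hQ
  -- the elimination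
  obtain ⟨h2, h2'⟩ := den_loop_write (n := n) (ρ := ρ) (a := 4) (x := 1) (off := 0) (α := α₁)
    (ie := .var 1) (e := .add (mem 5 1) (mem 6 1)) (val := fun i => α₁ 5 i + α₁ 6 i)
    (by simp [LExpr.eval]) (fun γ i _ hγ _ => by simp [LExpr.eval, mem, hγ 5, hγ 6])
  generalize (Cmd.loop 1 (.write 4 (.var 1) (.add (mem 5 1) (mem 6 1)))).den n ρ α₁ = α₂ at *
  have e4 : supp n α₂ 4 = supp n α₁ 5 ∪ supp n α₁ 6 := by
    ext v
    rw [mem_supp, h2', if_pos (by omega)]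
    simp only [Finset.mem_union, mem_supp, Nat.sub_zero]
    omega
  have e5 : supp n α₂ 5 = supp n α₁ 5 := supp_congr (h2 5 (by norm_num))
  have e6 : supp n α₂ 6 = supp n α₁ 6 := supp_congr (h2 6 (by norm_num))
  have e8 : supp n α₂ 8 = supp n α₁ 8 := supp_congr (h2 8 (by norm_num))
  have hα₂ := hα'.congr (h2 0 (by norm_num)) (h2 7 (by norm_num)) (h2 8 (by norm_num))
  have hs : IsSide G (supp n α₂ 5) (supp n α₂ 4) := by
    refine ⟨fun x hx y hxy => ?_, fun x hx y hxy => ?_⟩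
    · rw [e4, Finset.mem_union] at hx ⊢
      exact hx.symm.imp (hclosed x y hxy).2 (hclosed x y hxy).1
    · rw [e4, Finset.mem_union] at hx
      rw [e5]
      rcases hx with hx | hx
      · exact ⟨fun _ hy => hdisj y hy ((hclosed x y hxy).1 hx), fun _ => hx⟩
      · exact ⟨fun hx' => absurd hx (hdisj x hx'), fun hy => absurd ((hclosed x y hxy).2 hx) hy⟩
  have hinter : supp n α₂ 4 ∩ supp n α₂ 5 = supp n α₂ 5 := by
    rw [e4, e5]
    exact Finset.inter_eq_right.2 Finset.subset_union_left
  obtain ⟨h3, h4, -, -⟩ := den_elimination (ρ := ρ) (hα₂.hasAdj hG) rfl rfl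
    ⟨w, by rw [e4]; exact Finset.mem_union_left _ hstart⟩ hs hk
  rw [hinter] at h4
  have hα₃ := hα₂.congr (h3 0 (by norm_num) (by norm_num) (by norm_num) (by norm_num))
    (h3 7 (by norm_num) (by norm_num) (by norm_num) (by norm_num))
    (h3 8 (by norm_num) (by norm_num) (by norm_num) (by norm_num))
  have f5 : supp n (elimination.den n ρ α₂) 5 = supp n α₂ 5 :=
    supp_congr (h3 5 (by norm_num) (by norm_num) (by norm_num) (by norm_num))
  have f6 : supp n (elimination.den n ρ α₂) 6 = supp n α₂ 6 :=
    supp_congr (h3 6 (by norm_num) (by norm_num) (by norm_num) (by norm_num))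
  have f8 : supp n (elimination.den n ρ α₂) 8 = supp n α₂ 8 :=
    supp_congr (h3 8 (by norm_num) (by norm_num) (by norm_num) (by norm_num))
  have hacc := isTrue_acceptExpr (k := k) (ρ := ρ) (hα₃.hasAdj hG)
  rw [h4, f5] at hacc
  generalize elimination.den n ρ α₂ = α₃ at *
  by_cases hc : Dismantlable G (supp n α₂ 5) ∧ ∀ r ∈ supp n α₂ 5, TraceWidthLE G k r
  · rw [Cmd.den_ite_of_isTrue (hacc.2 hc)]
    obtain ⟨g0, g7, g8⟩ := den_commitSides (n := n) ρ α₃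
    rw [f5] at g7
    rw [f5, f6, e5, e6, ← e4] at g8
    generalize commitSides.den n ρ α₃ = α₄ at *
    have hnew : ∀ x ∈ supp n α₂ 4, x ∉ supp n α₃ 8 := fun x hx => by
      rw [f8, e8]
      rw [e4, Finset.mem_union] at hx
      exact hout' x hx
    have hnew5 : ∀ x ∈ supp n α₂ 5, x ∉ supp n α₃ 8 := fun x hx =>
      hnew x (Finset.inter_eq_right.1 hinter hx)
    refine ChoiceInv.succ ⟨(g0 0 (by norm_num) (by norm_num)).trans hα₃.frame,
      ⟨fun x hx y hxy => ?_, fun x hx y hxy => ?_⟩, ?_, ?_, fun r hr => ?_, fun v hv hlt => ?_⟩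
      fun _ => ?_
    · rw [g8, Finset.mem_union] at hx ⊢
      exact hx.imp (fun hx => hα₃.side.closed x hx y hxy) (fun hx => hs.closed x hx y hxy)
    · rw [g8, Finset.mem_union] at hx
      rw [g7, Finset.mem_union, Finset.mem_union]
      rcases hx with hx | hx
      · have h5 := hα₃.side.cross x hx y hxy
        have h6 : x ∉ supp n α₂ 5 := fun h' => hnew5 x h' hx
        have h7 : y ∉ supp n α₂ 5 := fun h' => hnew5 y h' (hα₃.side.closed x hx y hxy)
        tauto
      · have h5 := hs.cross x hx y hxy
        have h6 : x ∉ supp n α₃ 7 := fun h' => hnew x hx (hα₃.subset h')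
        have h7 : y ∉ supp n α₃ 7 := fun h' => hnew y (hs.closed x hx y hxy) (hα₃.subset h')
        tauto
    · rw [g7, g8]
      exact Finset.union_subset_union hα₃.subset (Finset.inter_eq_right.1 hinter)
    · rw [g7]
      refine hα₃.dismantlable.union hc.1
        (Finset.disjoint_left.2 fun x hx hx' => hnew5 x hx' (hα₃.subset hx))
        fun x hx y hy b hbx hby => hnew5 y hy ?_
      exact hα₃.side.closed b (hα₃.side.closed x (hα₃.subset hx) b hbx.symm) y hby
    · rw [g7, Finset.mem_union] at hr
      exact hr.elim (hα₃.width r) (hc.2 r)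
    · rw [g8]
      exact Finset.mem_union_left _ (hα₃.processed v hv hlt)
    · rw [g8, e4]
      exact Finset.mem_union_right _ (Finset.mem_union_left _ hstart)
  · rw [Cmd.den_ite_of_not fun h' => hc (hacc.1 h')]
    -- A rejection is impossible for `w ∈ A₀`: the side would be `A₀` restricted to the component,
    -- which inherits dismantlability and narrow traces.
    refine hα₃.succ fun hwA => absurd ?_ hc
    have hsub : supp n α₂ 5 = A₀.filter fun x => x ∈ supp n α₂ 4 := by
      ext x
      rw [Finset.mem_filter, e4, e5, Finset.mem_union]
      constructor
      · exact fun hx => ⟨(hside x hx).2 hwA, Or.inl hx⟩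
      · rintro ⟨hxA, hx | hx⟩
        · exact hx
        · exact absurd hwA ((hside' x hx).1 hxA)
    refine ⟨?_, fun r hr => hA₀w r ?_⟩
    · rw [hsub]
      exact hd.filter _ fun x y hx hxy => hs.closed x hx y hxy
    · rw [hsub, Finset.mem_filter] at hr
      exact hr.1

/-! ### The program -/

/-- Compute the parent function of a branch decomposition in array `2` and the leaves in
array `1`. -/
def decompose (k : ℕ) : Cmd :=
  .seq (.loop 10 (tryVertex k)) <|
  .seq (.loop 1 (.write 5 (.var 1) (mem 7 1))) <|
  .seq (.loop 1 (.write 4 (.var 1) (.const 1))) <|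
  .seq elimination <|
  .loop 1 (.write 1 (.var 1) (.var 1))

/-- Write the adjacency matrix of the tree with the parent function in array `2` to array `0`. -/
def outputTree : Cmd :=
  .loop 1 <| .loop 2 <| .write 0 (.add (.sum 3 (.var 1)) (.var 2))
    (or (eq (mem 2 1) (.var 2)) (eq (mem 2 2) (.var 1)))

/-- The chosen side has the same properties as the unknown `A₀`, so the final elimination reaches a
single root with all cuts bounded. -/
lemma den_decompose {A₀ : Finset (Fin n)} (hn : 0 < n) (hG : HasAdj G α) (hk : 1 ≤ k)
    (hA₀ : IsSide G A₀ Finset.univ) (hd : Dismantlable G A₀) (hA₀w : ∀ r ∈ A₀, TraceWidthLE G k r)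
    (h7 : α 7 = 0) (h8 : α 8 = 0) :
    (∀ v : Fin n, (decompose k).den n ρ α 1 v = v) ∧
    ∃ par, (decompose k).den n ρ α 2 = par ∧ ∃ hp : IsParentMap n (2 * n - 1) par,
      hp.toBranchDecomposition.mimw G ≤ k := by
  have hinv : ChoiceInv G k A₀ α n ((Cmd.loop 10 (tryVertex k)).den n ρ α) := by
    refine iter_induction (I := ChoiceInv G k A₀ α) ?_ fun i hi γ hγ =>
      den_tryVertex (w := ⟨i, hi⟩) hG hk hA₀ hd hA₀w (by simp) hγ
    have e7 : supp n α 7 = ∅ := by ext v; simp [h7]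
    have e8 : supp n α 8 = ∅ := by ext v; simp [h8]
    refine ⟨rfl, ?_, ?_, ?_, ?_, fun v _ hv => by omega⟩
    · rw [e7, e8]; exact ⟨by simp, by simp⟩
    · rw [e7]; simp
    · rw [e7]; exact .base (by simp)
    · rw [e7]; simp
  simp only [decompose, Cmd.den_seq]
  generalize (Cmd.loop 10 (tryVertex k)).den n ρ α = α₁ at *
  obtain ⟨h2, h2'⟩ := den_loop_write (n := n) (ρ := ρ) (a := 5) (x := 1) (off := 0) (α := α₁)
    (ie := .var 1) (e := mem 7 1) (val := fun i => α₁ 7 i)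
    (by simp [LExpr.eval]) (fun γ i _ hγ _ => by simp [LExpr.eval, mem, hγ 7])
  generalize (Cmd.loop 1 (.write 5 (.var 1) (mem 7 1))).den n ρ α₁ = α₂ at *
  obtain ⟨h3, h3'⟩ := den_loop_write (n := n) (ρ := ρ) (a := 4) (x := 1) (off := 0) (α := α₂)
    (ie := .var 1) (e := .const 1) (val := fun _ => 1)
    (by simp [LExpr.eval]) (fun γ i _ hγ _ => by simp [LExpr.eval])
  generalize (Cmd.loop 1 (.write 4 (.var 1) (.const 1))).den n ρ α₂ = α₃ at *
  have e5 : supp n α₃ 5 = supp n α₁ 7 := by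
    rw [supp_congr (h3 5 (by norm_num))]
    ext v
    rw [mem_supp, mem_supp, h2', if_pos (by omega), Nat.sub_zero]
  have e4 : supp n α₃ 4 = Finset.univ := by
    ext v
    rw [mem_supp, h3', if_pos (by omega)]
    simp
  have hα₃ : HasAdj G α₃ := by
    intro i j
    rw [h3 0 (by norm_num), h2 0 (by norm_num), hinv.frame]
    exact hG i j
  -- Every edge has an end in `A₀`, and all of `A₀` has been processed, so each edge lies in a
  -- processed component. Unprocessed vertices are isolated and do not matter.
  have hs : IsSide G (supp n α₁ 7) Finset.univ := by
    refine ⟨fun _ _ _ _ => Finset.mem_univ _, fun x _ y hxy => ?_⟩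
    refine hinv.side.cross x ?_ y hxy
    by_cases hx : x ∈ A₀
    · exact hinv.processed x hx x.2
    · have hy : y ∈ A₀ := by
        by_contra hy
        exact hx ((hA₀.cross x (Finset.mem_univ _) y hxy).2 hy)
      exact hinv.side.closed y (hinv.processed y hy y.2) x hxy.symm
  obtain ⟨-, h4, h4', h5⟩ := den_elimination (ρ := ρ) hα₃ e5 e4 ⟨⟨0, hn⟩, Finset.mem_univ _⟩ hs hk
  rw [Finset.univ_inter] at h4
  generalize elimination.den n ρ α₃ = α₄ at *
  obtain ⟨h6, h6'⟩ := den_loop_write (n := n) (ρ := ρ) (a := 1) (x := 1) (off := 0) (α := α₄)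
    (ie := .var 1) (e := .var 1) (val := id)
    (by simp [LExpr.eval]) (fun γ i _ hγ _ => by simp [LExpr.eval])
  refine ⟨fun v => by rw [h6', if_pos (by omega)]; simp, ?_⟩
  refine ⟨_, h6 2 (by norm_num), (h5 rfl hinv.width).exists_branchDecomposition ?_⟩
  exact le_antisymm (h4.2 hinv.dismantlable) (Finset.card_pos.2 h4')

lemma den_outputTree (m : ℕ) (ρ : ℕ → ℕ) (α : Arrays) :
    (∀ a, a ≠ 0 → outputTree.den m ρ α a = α a) ∧ ∀ x < m, ∀ y < m,
      (outputTree.den m ρ α 0 (x * m + y) ≠ 0 ↔ α 2 x = y ∨ α 2 y = x) := by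
  have hinj : ∀ x y x' y', y < m → y' < m → m * x + y = m * x' + y' → x = x' ∧ y = y' := by
    intro x y x' y' hy hy' h
    have hm : 0 < m := by omega
    have h1 := congrArg (· / m) h
    have h2 := congrArg (· % m) h
    simp only [Nat.mul_add_div hm, Nat.mul_add_mod, Nat.div_eq_of_lt hy, Nat.div_eq_of_lt hy',
      Nat.mod_eq_of_lt hy, Nat.mod_eq_of_lt hy'] at h1 h2
    exact ⟨h1, h2⟩
  suffices h : (∀ a, a ≠ 0 → outputTree.den m ρ α a = α a) ∧ ∀ x < m, ∀ y < m,
      (outputTree.den m ρ α 0 (m * x + y) ≠ 0 ↔ α 2 x = y ∨ α 2 y = x) by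
    refine ⟨h.1, fun x hx y hy => ?_⟩
    rw [Nat.mul_comm]
    exact h.2 x hx y hy
  refine iter_induction (I := fun i (β : Arrays) => (∀ a, a ≠ 0 → β a = α a) ∧ ∀ x < i, ∀ y < m,
    (β 0 (m * x + y) ≠ 0 ↔ α 2 x = y ∨ α 2 y = x)) ⟨fun _ _ => rfl, by simp⟩ fun i hi β hβ => ?_
  have := iter_induction (f := fun j β => (Cmd.write 0 (.add (.sum 3 (.var 1)) (.var 2))
      (or (eq (mem 2 1) (.var 2)) (eq (mem 2 2) (.var 1)))).den m
      (Function.update (Function.update ρ 1 i) 2 j) β) (n := m) (s := β)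
    (I := fun j (β : Arrays) => (∀ a, a ≠ 0 → β a = α a) ∧
      (∀ x < i, ∀ y < m, (β 0 (m * x + y) ≠ 0 ↔ α 2 x = y ∨ α 2 y = x)) ∧
      ∀ y < j, (β 0 (m * i + y) ≠ 0 ↔ α 2 i = y ∨ α 2 y = i)) ⟨hβ.1, hβ.2, by simp⟩
    fun j hj γ hγ => ?_
  · refine ⟨this.1, fun x hx y hy => ?_⟩
    rcases Nat.lt_succ_iff_lt_or_eq.1 hx with hx | rfl
    · exact this.2.1 x hx y hy
    · exact this.2.2 y hy
  · have hidx : (LExpr.add (.sum 3 (.var 1)) (.var 2)).eval m γ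
        (Function.update (Function.update ρ 1 i) 2 j) = m * i + j := by
      simp [LExpr.eval]
    have hval : (or (eq (mem 2 1) (.var 2)) (eq (mem 2 2) (.var 1))).eval m γ
        (Function.update (Function.update ρ 1 i) 2 j) ≠ 0 ↔ α 2 i = j ∨ α 2 j = i := by
      have := isTrue_or (n := m) (α := γ) (ρ := Function.update (Function.update ρ 1 i) 2 j)
        (e := eq (mem 2 1) (.var 2)) (f := eq (mem 2 2) (.var 1))
      rw [isTrue_eq, isTrue_eq] at this
      rw [← hγ.1 2 (by norm_num)]
      simpa [LExpr.eval, mem, IsTrue] using this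
    rw [Cmd.den, hidx]
    refine ⟨fun a ha => ?_, fun x hx y hy => ?_, fun y hy => ?_⟩
    · rw [← hγ.1 a ha]
      ext l
      simp [Arrays.set_apply, ha]
    · rw [Arrays.set_apply, if_neg fun h' => ?_]
      · exact hγ.2.1 x hx y hy
      · have := (hinj x y i j hy hj h'.2).1
        omega
    · rw [Arrays.set_apply]
      rcases Nat.lt_succ_iff_lt_or_eq.1 hy with hy | rfl
      · rw [if_neg fun h' => ?_]
        · exact hγ.2.2 y hy
        · omega
      · rw [if_pos ⟨rfl, rfl⟩]
        exact hval

end Choice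

/-! ### The program on the input state -/

lemma represents_inputState {n : ℕ} (G : SimpleGraph (Fin n)) :
    Represents n (fun _ => 0) (inputState G).arr (inputState G) :=
  ⟨rfl, fun x => by simp [inputState, vreg], rfl⟩

lemma hasAdj_inputState {n : ℕ} (G : SimpleGraph (Fin n)) : HasAdj G (inputState G).arr := by
  intro i j
  have hinj : ∀ i' j' : Fin n, n * (i : ℕ) + j = i' * n + j' → i = i' ∧ j = j' := by
    intro i' j' h
    have hn : 0 < n := i.pos
    rw [Nat.mul_comm (i' : ℕ)] at h
    have h1 := congrArg (· / n) h
    have h2 := congrArg (· % n) h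
    simp only [Nat.mul_add_div hn, Nat.mul_add_mod, Nat.div_eq_of_lt j.2, Nat.div_eq_of_lt j'.2,
      Nat.mod_eq_of_lt j.2, Nat.mod_eq_of_lt j'.2] at h1 h2
    exact ⟨Fin.ext h1, Fin.ext h2⟩
  simp only [inputState, true_and, ne_eq, ite_eq_right_iff, one_ne_zero, imp_false, not_not]
  constructor
  · rintro ⟨i', j', hadj, h⟩
    obtain ⟨rfl, rfl⟩ := hinj i' j' h
    exact hadj
  · exact fun hadj => ⟨i, j, hadj, by rw [Nat.mul_comm]⟩

lemma eval_mono (p : Polynomial ℕ) {a b : ℕ} (h : a ≤ b) : p.eval a ≤ p.eval b := by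
  rw [Polynomial.eval_eq_sum, Polynomial.eval_eq_sum]
  exact Finset.sum_le_sum fun i _ => Nat.mul_le_mul_left _ (Nat.pow_le_pow_left h i)

theorem computableWithin_isTreeConvex {t Δ : ℕ} (hΔ : 3 ≤ Δ) :
    ComputableWithin (fun {n : ℕ} (G : SimpleGraph (Fin n)) => IsTreeConvex t Δ G)
      (mimBound t Δ) := by
  -- Register `0` is both the loop length and the reported size. Between the two stages it is raised
  -- from `n` to `n + (n - 1)`, so that the output loops run over all nodes of the tree; this is why
  -- the second running time is composed with `2 * X`.
  refine ⟨.seq ((decompose (mimBound t Δ)).code 0) <|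
    .seq (.assign 0 (.add (.reg 0) (.sub (.reg 0) (.const 1)))) <| outputTree.code 0,
    (decompose (mimBound t Δ)).time + (6 + outputTree.time.comp (2 * Polynomial.X)),
    fun n G hG => ?_⟩
  obtain ⟨A, hne, hside, hd, hw⟩ := hG.exists_side hΔ
  have hn : 0 < n := hne.choose.pos
  have hk : 1 ≤ mimBound t Δ := le_trans (by omega) (le_mimBound (t := t) hΔ)
  obtain ⟨hleaf, par, hpar, hp, hmim⟩ := den_decompose (ρ := fun _ => 0) hn (hasAdj_inputState G)
    hk hside hd hw (by ext; simp [inputState]) (by ext; simp [inputState])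
  obtain ⟨s₁, k₁, hk₁, hle₁, hr₁, -⟩ := (decompose (mimBound t Δ)).exec_code n 0 _ _ _
    (represents_inputState G)
  generalize (decompose (mimBound t Δ)).den n (fun _ => 0) (inputState G).arr = α at *
  have hr₂ : Represents (2 * n - 1) (fun _ => 0) α (s₁.setReg 0 (2 * n - 1)) :=
    ⟨by simp [setReg_reg], fun x => by
      rw [setReg_reg, if_neg (by simp [vreg]), hr₁.var], hr₁.arr⟩
  obtain ⟨s₂, k₂, hk₂, hle₂, hr₃, -⟩ := outputTree.exec_code (2 * n - 1) 0 _ _ _ hr₂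
  have hassign : Exec (.assign 0 (.add (.reg 0) (.sub (.reg 0) (.const 1)))) s₁
      (s₁.setReg 0 (2 * n - 1)) 6 := by
    have := exec_assign s₁ 0 (.add (.reg 0) (.sub (.reg 0) (.const 1)))
    simpa only [Expr.eval, Expr.cost, hr₁.len, show n + (n - 1) = 2 * n - 1 by omega] using this
  obtain ⟨h0, hadj⟩ := den_outputTree (2 * n - 1) (fun _ => 0) α
  refine ⟨s₂, _, hp.toBranchDecomposition, Exec.seq hk₁ (Exec.seq hassign hk₂), ?_,
    ⟨hr₃.len, fun x y => ?_, fun v => ?_⟩, hmim⟩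
  · rw [Polynomial.eval_add, Polynomial.eval_add, Polynomial.eval_comp]
    have h1 := eval_mono outputTree.time (show 2 * n - 1 ≤ 2 * n by omega)
    have h2 : (6 : Polynomial ℕ).eval n = 6 := Polynomial.eval_ofNat 6 n
    have h3 : (2 * Polynomial.X : Polynomial ℕ).eval n = 2 * n := by simp
    rw [h2, h3]
    omega
  · rw [hr₃.arr]
    refine Iff.trans ?_ (hadj x x.2 y y.2).symm
    rw [hpar]
    rfl
  · rw [hr₃.arr, h0 1 (by norm_num), hleaf]
    rfl

/-! ### Isomorphic graphs -/

section Iso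

variable {V : Type u} {W : Type v}

lemma deg_comap (H : SimpleGraph W) (f : V ≃ W) (x : V) : deg (H.comap f) x = deg H (f x) := by
  unfold deg
  have : (H.comap f).neighborSet x = f ⁻¹' H.neighborSet (f x) := rfl
  rw [this, Set.encard_preimage_of_bijective f.bijective]

lemma IsTreeConvex.comap {t Δ : ℕ} {G : SimpleGraph W} (hG : IsTreeConvex t Δ G) (e : V ≃ W) :
    IsTreeConvex t Δ (G.comap e) := by
  obtain ⟨A, B, hAB, hbip, H, hH, hconn⟩ := hG
  let f : (e ⁻¹' A) ≃ A := e.subtypeEquiv fun _ => Iff.rfl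
  refine ⟨e ⁻¹' A, e ⁻¹' B, by rw [← Set.preimage_union, hAB, Set.preimage_univ],
    ⟨hbip.disjoint.preimage e, fun x y hxy => hbip.mem_of_adj hxy⟩, H.comap f,
    ⟨(SimpleGraph.Iso.comap f H).isTree_iff.2 hH.isTree, fun w => ?_, ?_⟩, fun b hb => ?_⟩
  · rw [deg_comap]
    exact hH.deg_le _
  · have : {w | 3 ≤ deg (H.comap f) w} = f ⁻¹' {w | 3 ≤ deg H w} := by
      ext w
      simp only [Set.mem_ofPred_eq, Set.mem_preimage, deg_comap]
    rw [this, Set.encard_preimage_of_bijective f.bijective]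
    exact hH.branching_le
  · let g : H.induce {a : A | G.Adj (e b) a} →g
        (H.comap f).induce {a : e ⁻¹' A | (G.comap e).Adj b a} :=
      { toFun := fun a => ⟨f.symm a, by
          have h1 : e (f.symm a : V) = a := congrArg Subtype.val (f.apply_symm_apply a)
          change G.Adj (e b) (e (f.symm a : V))
          rw [h1]
          exact a.2⟩
        map_rel' := fun {a a'} h => by
          simpa using h }
    refine SimpleGraph.Preconnected.map g (fun a => ⟨⟨f a, a.2⟩, ?_⟩) (hconn (e b) hb)
    exact Subtype.ext (f.symm_apply_apply a)

lemma cutMim_comap_le (G : SimpleGraph W) (e : V ≃ W) (X : Set W) :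
    cutMim (G.comap e) (e ⁻¹' X) ≤ cutMim G X := by
  refine iSup₂_le fun M hM => ?_
  rw [← (Sym2.map.injective e.injective).encard_image M]
  refine le_iSup₂_of_le (Sym2.map e '' M) ⟨?_, ?_⟩ le_rfl
  · rintro _ ⟨m, hm, rfl⟩
    have := hM.1 hm
    induction m using Sym2.ind
    exact this
  · rintro _ ⟨m, hm, rfl⟩ _ ⟨m', hm', rfl⟩ hne x hx y hy
    rw [Sym2.mem_map] at hx hy
    obtain ⟨x, hx, rfl⟩ := hx
    obtain ⟨y, hy, rfl⟩ := hy
    have := hM.2 m hm m' hm' (fun h => hne (by rw [h])) x hx y hy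
    exact ⟨fun h => this.1 (e.injective h), this.2⟩

/-- The branch decomposition of a set in bijection with `W`. -/
def BranchDecomposition.comap (D : BranchDecomposition W) (e : V ≃ W) : BranchDecomposition V :=
  { D with δ := e.trans D.δ }

lemma BranchDecomposition.mimw_comap_le (D : BranchDecomposition W) (e : V ≃ W)
    (G : SimpleGraph W) : (D.comap e).mimw (G.comap e) ≤ D.mimw G :=
  iSup_mono fun x => iSup_mono fun y => iSup_mono fun _ => cutMim_comap_le G e (D.side x y)

end Iso

/-- Numbering the vertices turns the graph into an admissible input, and the decomposition output by
the program is carried back along the numbering. -/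
theorem IsTreeConvex.mimWidth_le {t Δ : ℕ} (hΔ : 3 ≤ Δ) {V : Type u} [Finite V]
    {G : SimpleGraph V} (hG : IsTreeConvex t Δ G) : mimWidth G ≤ mimBound t Δ := by
  obtain ⟨p, time, h⟩ := computableWithin_isTreeConvex (t := t) hΔ
  let e : V ≃ Fin (Nat.card V) := Finite.equivFin V
  obtain ⟨-, -, D, -, -, -, hD⟩ := h _ _ (hG.comap e.symm)
  have := D.mimw_comap_le e (G.comap e.symm)
  rw [SimpleGraph.comap_comap] at this
  refine (iInf_le _ (D.comap e)).trans (le_trans (le_of_eq ?_) (this.trans hD))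
  congr
  ext x y
  simp

end TreeConvex

theorem theorem2 (t Δ : ℕ) (ht : 1 ≤ t) (hΔ : 3 ≤ Δ) :
    (∀ (V : Type*) [Finite V] (G : SimpleGraph V),
      TreeConvex.IsTreeConvex t Δ G →
        TreeConvex.mimWidth G ≤ (TreeConvex.mimBound t Δ : ℕ∞)) ∧
    TreeConvex.ComputableWithin
      (fun {n : ℕ} (G : SimpleGraph (Fin n)) => TreeConvex.IsTreeConvex t Δ G)
      (TreeConvex.mimBound t Δ) := by
  exact ⟨fun _ _ _ hG => hG.mimWidth_le hΔ, TreeConvex.computableWithin_isTreeConvex hΔ⟩
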